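/- **Setting (target).** Let $E$ be a finite-dimensional real vector space and let $(v,x,y)\in E\times\mathbb C\times\mathbb C$ be coordinates on an open set $U$ of a manifold $Z$. Put $Z_\lambda=\{xy=\lambda\}$ for $\lambda\neq0$, $X=\{y=0\}$, $Y=\{x=0\}$, $V=X\cap Y=\{x=y=0\}$. Let $g$ be a smooth Riemannian metric and $J$ a smooth almost complex structure on $U$ which preserves the tangent spaces $\{y\,dx+x\,dy=0\}$ of the fibers of $(v,x,y)\mapsto xy$. Let $g_X$, $g_\lambda$ be the metrics induced on $X$, $Z_\lambda$. For a tangent vector write $\xi^N$ for its component in the $(x,y)$-directions; $\xi$ is *tangent to $V$* ($\xi=\xi^V$) if $\xi^N=0$. **Setting (maps).** Let $C_0=C_1\cup C_2$ be a nodal curve with coordinates $z$ on $C_1$ and $w$ on $C_2$ near the node, defined for $|z|<R$, $|w|<R$, with $R>1$; let $C_\mu=\{zw=\mu\}$ be its smoothing, $\rho^2=|z|^2+|w|^2$, with the cylindrical metric $\rho^{-2}(|dz|^2+|dw|^2)$ on $C_\mu$ and on $C_0$. Let $f=(f_1,f_2)$, $f_1=(f_1^v,f_1^x):C_1\to X$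 and $f_2=(f_2^v,f_2^y):C_2\to Y$, be smooth maps with values in $U$, with $f_1(0)=f_2(0)=p\in V$, which meet $V$ only at the node, with multiplicity $s\ge1$: $f_1^x=az^s+O(|z|^{s+1})$, $f_2^y=bw^s+O(|w|^{s+1})$, $a,b\ne0$. Let $f$ vary in a family parametrized by a compact space, with all derivatives of $f_1,f_2$ continuous in the parameter and the point. Write $f_1=(p+h^v,\,az^s(1+h^x))$. For $\lambda\ne0$ and $\mu$ with $ab\mu^s=\lambda$, and a smooth cutoff $0\le\beta\le1$ on $C_\mu$ with $\beta=1$ for $\rho\le|\mu|^{1/4}$, $\beta=0$ for $\rho\ge2|\mu|^{1/4}$ and $|d\beta|\le2$ in the cylindrical metric, the approximate map $F:C_\mu\to Z_\lambda$ is $$F=\bigl(p+(1-\beta)h^v,\ az^s(1+(1-\beta)h^x),\ bw^s(1+(1-\beta)h^x)^{-1}\bigr)\qquad\text{on }|w|\le|z|,$$ and is given by the same formula with $f_1,z,x,a$ and $f_2,w,y,b$ exchanged on $|z|<|w|$. **The map $\xi\mapsto\hat\xi$.** Let $C_1(\mu)=C_1\cap\{|z|\ge|\mu|^{3/4}\}$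 and let $C_\mu^+$ be the part of $C_\mu$ with $|z|\ge|\mu|^{3/4}$; the projection $(z,w)\mapsto z$ identifies them. The projection $(v,x,y)\mapsto(v,x)$ identifies the region $x\ne0$ of $Z_\lambda$ with a region of $X$, and $TX$ is trivialized by the coordinates $(v,x)$. For a section $\xi$ of $f^*TX$ over $C_1(\mu)$, $\hat\xi$ is the section of $F^*TZ_\lambda$ over $C_\mu^+$ given by $\hat\xi(z)=\xi(z)$ under these identifications; that is, if $\xi(z)=(\xi^v,\xi^x)$ then $$\hat\xi(z)=\bigl(\xi^v,\ \xi^x,\ -\lambda\,(F^x(z))^{-2}\,\xi^x\bigr)\in T_{F(z)}Z_\lambda .$$ For an $f^*TX$-valued 1-form $\eta$ let $\hat\eta(u)=\widehat{\eta(u)}$ for $u\in T_zC$. For a $(0,1)$-form $\eta=\sigma\,d\bar z$ ($\sigma$ a section of $f^*TX$) consider also the $(0,1)$-form $\tilde\eta=\hat\sigma\,d\bar z$ with values in $F^*TZ_\lambda$. **Lemma.** For each $M>0$ let $\Omega_M^+$ be the region $M^{-1}|w|\le|z|\le1$ of $C_\mu$. There are constants $c_M,\lambda_M>0$, depending only on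 $M$, $(U,g,J)$, $s$ and the compact family of maps (and not on the member $f$ of the family, nor on $\lambda,\mu,\beta,\xi$ or the point), such that whenever $0<|\lambda|\le\lambda_M$, at each point of $\Omega_M^+$ the image of $F$ lies in $Z_\lambda\cap U$ and every section $\xi$ of $f^*TX$ satisfies $$c_M^{-1}|\xi|\le|\hat\xi|\le c_M|\xi|,\qquad |\nabla\hat\xi|\le c_M\bigl(|\nabla\xi|+|\xi|\bigr),$$ where the norms are those of $g_X$, $g_\lambda$ and the cylindrical metrics, and $\nabla$ is the pull-back by $f$, respectively $F$, of the Levi-Civita connection of $g_X$, respectively $g_\lambda$ (and the Levi-Civita connection of the cylindrical metric on forms). The same estimates hold for $\eta\mapsto\hat\eta$ on all $f^*TX$-valued 1-forms, and for $\eta\mapsto\tilde\eta$ on all $(0,1)$-forms. Furthermore, if $\xi=\xi^V$ then $(\hat\xi)^N=0$; if $\eta(u)^N=0$ for all $u$ then $\hat\eta(u)^N=0$ for all $u$; and, for $\eta=\sigma\,d\bar z$, if $\sigma^N=0$ then the coefficient $\hat\sigma$ of $\tilde\eta$ has $\hat\sigma^N=0$. -/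

import Mathlib

open Set Filter Topology Asymptotics
open scoped ContDiff

noncomputable section

namespace SymplecticSum

/-! ### Riemannian metrics in a chart and their Levi-Civita connections -/

section Riemannian

variable {W W' : Type*} [NormedAddCommGroup W] [NormedSpace ℝ W]
  [NormedAddCommGroup W'] [NormedSpace ℝ W']

/-- The pointwise norm `|u|` of a tangent vector `u` at `q`. -/
def vecNorm (G : W → W →L[ℝ] W →L[ℝ] ℝ) (q u : W) : ℝ := √(G q u u)

/-- The metric induced by `G` through a map `i`. -/
def pullbackMetric (i : W' → W) (G : W → W →L[ℝ] W →L[ℝ] ℝ) :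
    W' → W' →L[ℝ] W' →L[ℝ] ℝ :=
  fun q => (G (i q)).bilinearComp (fderiv ℝ i q) (fderiv ℝ i q)

/-- The Christoffel symbols of the Levi-Civita connection of `G`: the vector `Γ_q(u,v)` with
`2 G(Γ(u,v), w) = (∂_u G)(v,w) + (∂_v G)(u,w) - (∂_w G)(u,v)` for all `w`. -/
def christoffel (G : W → W →L[ℝ] W →L[ℝ] ℝ) (q u v : W) : W :=
  (G q).inverse ((2⁻¹ : ℝ) •
    (fderiv ℝ G q u v + fderiv ℝ G q v u - ((fderiv ℝ G q).flip u).flip v))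

/-- The pull-back by `φ` of the Levi-Civita connection of `G`: the covariant derivative at `z`, in
the direction `u`, of a section `ξ` of `φ^* TW`. -/
def covAlong (G : W → W →L[ℝ] W →L[ℝ] ℝ) (φ ξ : ℂ → W) (z u : ℂ) : W :=
  fderiv ℝ ξ z u + christoffel G (φ z) (fderiv ℝ φ z u) (ξ z)

end Riemannian

/-! ### The domains: `z w = μ` with the cylindrical metric, in the coordinate `z` -/

/-- `ρ² = |z|² + |w|²` on the curve `z w = μ`. -/
def rho (mu z : ℂ) : ℝ := √(‖z‖ ^ 2 + ‖mu / z‖ ^ 2)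

/-- The cylindrical metric `ρ⁻² (|dz|² + |dw|²)` on `z w = μ` is this multiple of `|dz|²`, as
`dw = -(μ / z²) dz`. For `μ = 0` it is the cylindrical metric `|dz|² / |z|²` on the branch `C₁`. -/
def cylDensity (mu z : ℂ) : ℝ := (1 + ‖mu / z ^ 2‖ ^ 2) / rho mu z ^ 2

/-- The cylindrical metric. -/
def cylMetric (mu : ℂ) : ℂ → ℂ →L[ℝ] ℂ →L[ℝ] ℝ := fun z =>
  cylDensity mu z •
    (Complex.reCLM.smulRight Complex.reCLM + Complex.imCLM.smulRight Complex.imCLM)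

/-- The Hilbert-Schmidt norm of a linear map `A` on `T_z ℂ`, where `T_z ℂ` has the metric
`d |dz|²` and the target has the norm `N`. -/
def coNorm {A' : Type*} (d : ℝ) (N : A' → ℝ) (A : ℂ → A') : ℝ :=
  √((N (A 1) ^ 2 + N (A Complex.I) ^ 2) / d)

/-- The covariant derivative of a bundle valued 1-form `η`, for the Levi-Civita connection of the
cylindrical metric and the connection `cov` on the bundle:
`(∇_u η)(v) = ∇_u (η(v)) - η(∇_u v)`, for constant `v`. -/
def covForm {W : Type*} [NormedAddCommGroup W] [NormedSpace ℝ W] (mu : ℂ)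
    (cov : (ℂ → W) → ℂ → ℂ → W) (η : ℂ → ℂ →L[ℝ] W) (z u v : ℂ) : W :=
  cov (fun z' => η z' v) z u - η z (christoffel (cylMetric mu) z u v)

/-- The part of `C₁(μ)` in the coordinate disk: `|μ|^{3/4} ≤ |z| < R`. -/
def plusRegion (mu : ℂ) (R : ℝ) : Set ℂ := {z | ‖mu‖ ^ (3 / 4 : ℝ) ≤ ‖z‖ ∧ ‖z‖ < R}

/-- The region `Ω_M⁺` of the curve `z w = μ`, in the coordinate `z`. -/
def omegaPlus (M : ℝ) (mu : ℂ) : Set ℂ := {z | z ≠ 0 ∧ M⁻¹ * ‖mu / z‖ ≤ ‖z‖ ∧ ‖z‖ ≤ 1}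

/-- Cutoff functions on the curve `z w = μ`, equal to `1` for `ρ ≤ |μ|^{1/4}` and to `0` for
`ρ ≥ 2 |μ|^{1/4}`, with differential at most `2` in the cylindrical metric. -/
structure IsCutoff (mu : ℂ) (β : ℂ → ℝ) : Prop where
  smooth : ContDiffOn ℝ ∞ β {z | z ≠ 0}
  nonneg : ∀ z, z ≠ 0 → 0 ≤ β z
  le_one : ∀ z, z ≠ 0 → β z ≤ 1
  eq_one : ∀ z, z ≠ 0 → rho mu z ≤ ‖mu‖ ^ (1 / 4 : ℝ) → β z = 1
  eq_zero : ∀ z, z ≠ 0 → 2 * ‖mu‖ ^ (1 / 4 : ℝ) ≤ rho mu z → β z = 0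
  deriv_le : ∀ z, z ≠ 0 → coNorm (cylDensity mu z) (fun r : ℝ => |r|) (fderiv ℝ β z) ≤ 2

/-! ### The target: coordinates `(v, x, y)` on `Z`, with `Z_λ = {x y = λ}`, `X = {y = 0}`,
`Y = {x = 0}` and `V = {x = y = 0}` -/

section Target

variable {E : Type*} [NormedAddCommGroup E] [NormedSpace ℝ E]

/-- The projection `(v, x, y) ↦ (v, x)`. -/
def proj : E × ℂ × ℂ →L[ℝ] E × ℂ :=
  (ContinuousLinearMap.fst ℝ E (ℂ × ℂ)).prod
    ((ContinuousLinearMap.fst ℝ ℂ ℂ).comp (ContinuousLinearMap.snd ℝ E (ℂ × ℂ)))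

/-- The inclusion `(v, x) ↦ (v, x, 0)` of `X` in `Z`. -/
def xIncl : E × ℂ →L[ℝ] E × ℂ × ℂ :=
  (ContinuousLinearMap.fst ℝ E ℂ).prod ((ContinuousLinearMap.snd ℝ E ℂ).prod 0)

/-- The inverse `(v, x) ↦ (v, x, λ / x)` of the projection of `Z_λ`, for `x ≠ 0`. -/
def fiberIncl (lam : ℂ) (q : E × ℂ) : E × ℂ × ℂ := (q.1, q.2, lam / q.2)

/-- A Riemannian metric `g` and an almost complex structure `J` on the coordinate domain `U` of `Z`,
where `J` preserves the tangent spaces `{y dx + x dy = 0}` of the fibers of `(v, x, y) ↦ x y`. -/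
structure IsLocalModel (U : Set (E × ℂ × ℂ))
    (g : E × ℂ × ℂ → (E × ℂ × ℂ) →L[ℝ] (E × ℂ × ℂ) →L[ℝ] ℝ)
    (J : E × ℂ × ℂ → (E × ℂ × ℂ) →L[ℝ] (E × ℂ × ℂ)) : Prop where
  isOpen : IsOpen U
  smooth_g : ContDiffOn ℝ ∞ g U
  symm : ∀ q ∈ U, ∀ u v, g q u v = g q v u
  pos : ∀ q ∈ U, ∀ u, u ≠ 0 → 0 < g q u u
  smooth_J : ContDiffOn ℝ ∞ J U
  sq : ∀ q ∈ U, ∀ u, J q (J q u) = -u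
  fiber : ∀ q ∈ U, ∀ u : E × ℂ × ℂ, q.2.2 * u.2.1 + q.2.1 * u.2.2 = 0 →
    q.2.2 * (J q u).2.1 + q.2.1 * (J q u).2.2 = 0

/-- The metric `g_X` on `X`. -/
def metricX (g : E × ℂ × ℂ → (E × ℂ × ℂ) →L[ℝ] (E × ℂ × ℂ) →L[ℝ] ℝ) :
    E × ℂ → (E × ℂ) →L[ℝ] (E × ℂ) →L[ℝ] ℝ :=
  pullbackMetric xIncl g

/-- The metric `g_λ` on `Z_λ`, in the coordinates `(v, x)`. -/
def metricFiber (g : E × ℂ × ℂ → (E × ℂ × ℂ) →L[ℝ] (E × ℂ × ℂ) →L[ℝ] ℝ) (lam : ℂ) :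
    E × ℂ → (E × ℂ) →L[ℝ] (E × ℂ) →L[ℝ] ℝ :=
  pullbackMetric (fiberIncl lam) g

/-- The almost complex structure of `X`. -/
def complexX (J : E × ℂ × ℂ → (E × ℂ × ℂ) →L[ℝ] (E × ℂ × ℂ)) (q : E × ℂ) :
    (E × ℂ) →L[ℝ] (E × ℂ) :=
  proj.comp ((J (xIncl q)).comp xIncl)

/-- The pull-back by `F` of the Levi-Civita connection of `(Z_λ, g_λ)`. A section `ζ` of
`F^* TZ_λ` is a function with values in `TZ`, tangent to `Z_λ`; so is its derivative. -/
def covFiber (g : E × ℂ × ℂ → (E × ℂ × ℂ) →L[ℝ] (E × ℂ × ℂ) →L[ℝ] ℝ) (lam : ℂ)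
    (F ζ : ℂ → E × ℂ × ℂ) (z u : ℂ) : E × ℂ × ℂ :=
  fderiv ℝ (fiberIncl lam) (proj (F z))
    (covAlong (metricFiber g lam) (fun z' => proj (F z')) (fun z' => proj (ζ z')) z u)

/-! ### The maps `f` and the approximate maps `F` -/

/-- A family of smooth maps on the disk `|z| < R` whose derivatives of every order are continuous
in the parameter and the point. -/
structure IsSmoothFamily {T : Type*} [TopologicalSpace T] (R : ℝ) (f : T → ℂ → E × ℂ) : Prop where
  smooth : ∀ t, ContDiffOn ℝ ∞ (f t) (Metric.ball 0 R)
  cont : ∀ k : ℕ, ContinuousOn (fun q : T × ℂ => iteratedFDeriv ℝ k (f q.1) q.2)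
    (univ ×ˢ Metric.ball 0 R)

/-- The map `f = (f^v, f^x)` on the disk `|z| < R` meets `V = {x = 0}` only at `z = 0`, in the point
`p`, with multiplicity `s` and leading coefficient `a`: `f^x = a z^s + O(|z|^{s+1})`, `a ≠ 0`. -/
structure HasContact (R : ℝ) (s : ℕ) (f : ℂ → E × ℂ) (p : E) (a : ℂ) : Prop where
  zero : f 0 = (p, 0)
  ne_zero : a ≠ 0
  leading : (fun z => (f z).2 - a * z ^ s) =O[𝓝 0] (fun z => z ^ (s + 1))
  only : ∀ z ∈ Metric.ball (0 : ℂ) R, z ≠ 0 → (f z).2 ≠ 0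

/-- A family of maps `f = (f₁, f₂) : C₁ ∪ C₂ → X ∪ Y` near a node which is mapped to `V` with
intersection multiplicity `s`, in coordinates `z` on `C₁` and `w` on `C₂`;
`f₁ = (f₁^v, f₁^x)` and `f₂ = (f₂^v, f₂^y)`. -/
structure NodalFamily (T : Type*) [TopologicalSpace T] (U : Set (E × ℂ × ℂ)) (s : ℕ) (R : ℝ) where
  f₁ : T → ℂ → E × ℂ
  f₂ : T → ℂ → E × ℂ
  p : T → E
  a : T → ℂ
  b : T → ℂ
  one_le : 1 ≤ s
  one_lt : 1 < R
  smooth₁ : IsSmoothFamily R f₁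
  smooth₂ : IsSmoothFamily R f₂
  mem₁ : ∀ t, ∀ z ∈ Metric.ball (0 : ℂ) R, ((f₁ t z).1, (f₁ t z).2, 0) ∈ U
  mem₂ : ∀ t, ∀ w ∈ Metric.ball (0 : ℂ) R, ((f₂ t w).1, 0, (f₂ t w).2) ∈ U
  contact₁ : ∀ t, HasContact R s (f₁ t) (p t) (a t)
  contact₂ : ∀ t, HasContact R s (f₂ t) (p t) (b t)

/-- The function `h` with `f^x = a z^s (1 + h)`. -/
def relError (s : ℕ) (f : ℂ → E × ℂ) (a z : ℂ) : ℂ := (f z).2 / (a * z ^ s) - 1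

/-- The approximate map `F` on the curve `z w = μ`, in the coordinate `z`. With
`f₁ = (p + h^v, a z^s (1 + h^x))`, it is
`(p + (1-β) h^v, a z^s (1 + (1-β) h^x), b w^s (1 + (1-β) h^x)⁻¹)` on the half `|w| ≤ |z|`;
on the other half the roles of `f₁, z, x` and `f₂, w, y` are exchanged. -/
def approxMap (s : ℕ) (f₁ f₂ : ℂ → E × ℂ) (p : E) (a b mu : ℂ) (β : ℂ → ℝ) (z : ℂ) : E × ℂ × ℂ :=
  let w := mu / z
  let k : ℝ := 1 - β z
  if ‖w‖ ≤ ‖z‖ then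
    (p + k • ((f₁ z).1 - p), a * z ^ s * (1 + (k : ℂ) * relError s f₁ a z),
      b * w ^ s * (1 + (k : ℂ) * relError s f₁ a z)⁻¹)
  else
    (p + k • ((f₂ w).1 - p), a * z ^ s * (1 + (k : ℂ) * relError s f₂ b w)⁻¹,
      b * w ^ s * (1 + (k : ℂ) * relError s f₂ b w))

/-! ### The identification map, on sections and on 1-forms -/

/-- The map `ξ ↦ ξ̂` on sections. In the chart `(v, x)`, which trivializes `f^* TX`, the vector
`ξ(z)` at `f(z)` is moved to the point `(F^v(z), F^x(z))` and then lifted to the vector tangent to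
`Z_λ` at `F(z)` that projects to it. -/
def hat (lam : ℂ) (F : ℂ → E × ℂ × ℂ) (ξ : ℂ → E × ℂ) (z : ℂ) : E × ℂ × ℂ :=
  fderiv ℝ (fiberIncl lam) (proj (F z)) (ξ z)

/-- The map `η ↦ η̂` on all bundle valued 1-forms: `η̂(u)` is the image of `η(u)`. -/
def hatForm (lam : ℂ) (F : ℂ → E × ℂ × ℂ) (η : ℂ → ℂ →L[ℝ] (E × ℂ)) (z : ℂ) :
    ℂ →L[ℝ] (E × ℂ × ℂ) :=
  (fderiv ℝ (fiberIncl lam) (proj (F z))).comp (η z)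

/-- `η` is of type `(0,1)` on `S`: `η ∘ i = -J ∘ η`. -/
def IsZeroOne (J : E × ℂ × ℂ → (E × ℂ × ℂ) →L[ℝ] (E × ℂ × ℂ)) (f : ℂ → E × ℂ) (S : Set ℂ)
    (η : ℂ → ℂ →L[ℝ] (E × ℂ)) : Prop :=
  ∀ z ∈ S, ∀ u, η z (Complex.I * u) = -complexX J (f z) (η z u)

/-- The map `η ↦ η̂` on `(0,1)`-forms, by their coefficients: it takes `η = σ dz̄`, `σ = η(∂_z)`
(the value on `1 ∈ ℂ = T_z C`), to `σ̂ dz̄`, where `(σ̂ dz̄)(u) = Re(u) σ̂ - Im(u) J σ̂`. -/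
def hatZeroOne (J : E × ℂ × ℂ → (E × ℂ × ℂ) →L[ℝ] (E × ℂ × ℂ)) (lam : ℂ)
    (F : ℂ → E × ℂ × ℂ) (η : ℂ → ℂ →L[ℝ] (E × ℂ)) (z : ℂ) : ℂ →L[ℝ] (E × ℂ × ℂ) :=
  Complex.reCLM.smulRight (hat lam F (fun z' => η z' 1) z) -
    Complex.imCLM.smulRight (J (F z) (hat lam F (fun z' => η z' 1) z))

/-! ### Pointwise norms, on `C₁` with values in `f^* TX` and on `C_μ` with values in `F^* TZ_λ` -/

section Norms

variable (g : E × ℂ × ℂ → (E × ℂ × ℂ) →L[ℝ] (E × ℂ × ℂ) →L[ℝ] ℝ)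

/-- `|∇ξ|` for a section of `f^* TX`. -/
def gradNormX (f ξ : ℂ → E × ℂ) (z : ℂ) : ℝ :=
  coNorm (cylDensity 0 z) (vecNorm (metricX g) (f z)) (covAlong (metricX g) f ξ z)

/-- `|∇ζ|` for a section of `F^* TZ_λ`. -/
def gradNormZ (lam mu : ℂ) (F ζ : ℂ → E × ℂ × ℂ) (z : ℂ) : ℝ :=
  coNorm (cylDensity mu z) (vecNorm g (F z)) (covFiber g lam F ζ z)

/-- `|η|` for a 1-form with values in `f^* TX`. -/
def formNormX (f : ℂ → E × ℂ) (η : ℂ → ℂ →L[ℝ] (E × ℂ)) (z : ℂ) : ℝ :=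
  coNorm (cylDensity 0 z) (vecNorm (metricX g) (f z)) (η z)

/-- `|η|` for a 1-form with values in `F^* TZ_λ`. -/
def formNormZ (mu : ℂ) (F : ℂ → E × ℂ × ℂ) (η : ℂ → ℂ →L[ℝ] (E × ℂ × ℂ)) (z : ℂ) : ℝ :=
  coNorm (cylDensity mu z) (vecNorm g (F z)) (η z)

/-- `|∇η|` for a 1-form with values in `f^* TX`. -/
def formGradNormX (f : ℂ → E × ℂ) (η : ℂ → ℂ →L[ℝ] (E × ℂ)) (z : ℂ) : ℝ :=
  coNorm (cylDensity 0 z) (coNorm (cylDensity 0 z) (vecNorm (metricX g) (f z)))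
    (covForm 0 (covAlong (metricX g) f) η z)

/-- `|∇η|` for a 1-form with values in `F^* TZ_λ`. -/
def formGradNormZ (lam mu : ℂ) (F : ℂ → E × ℂ × ℂ) (η : ℂ → ℂ →L[ℝ] (E × ℂ × ℂ)) (z : ℂ) : ℝ :=
  coNorm (cylDensity mu z) (coNorm (cylDensity mu z) (vecNorm g (F z)))
    (covForm mu (covFiber g lam F) η z)

end Norms

end Target

end SymplecticSum

end

noncomputable section

namespace SymplecticSum


/-! ### Taylor estimates from a vanishing order at the origin -/

section Taylor

variable {A B : Type*} [NormedAddCommGroup A] [NormedSpace ℝ A]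
  [NormedAddCommGroup B] [NormedSpace ℝ B]

/-! In the chart (v, x) the sections ξ and ξ̂ have the same components, so each side of an estimate
can be compared with the Euclidean quantities |ξ| and |z||∂ξ|. The weight |z| is common to both
sides, because the cylindrical metric is |dz|²/|z|² on every curve zw = μ (`cylDensity_eq`). What
remains is a uniform pointwise bound for the lift of tangent vectors and for the Christoffel
symbols, along f in X and along F in Z_λ. These bounds are collected in `LiftBounds`; X is the case
λ = 0.

The geometry of Z_λ in this chart is governed by the slope m = -λ/x² of the graph y = λ/x and by its
derivative -2m/x. On Ω_M⁺ one has |λ| ≲ |μ|^s, |μ| ≤ M|z|² and |x| ≳ |z|^s, so m is bounded. The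
pole 1/x does appear in the Christoffel symbols, but only multiplied by the x-component of the
direction of differentiation (`norm_christoffel_metricFiber_le`). Along the maps this component
satisfies |z||dx| ≲ |z|^s ≲ |x|, so the logarithmic scale of the cylinder cancels the pole
(`LocalBounds.liftBounds`). For (0,1)-forms the derivative of J along the lift is controlled in the
same way.

Two inputs carry the uniformity. Contact of order s, Taylor's formula and compactness of the family
give f^x = az^s + O(|z|^{s+1}) together with its derivative, with |a| bounded above and below
(`exists_contactBounds`). The cutoff has bounded logarithmic derivative, so the glued map keeps
these bounds (`gluedMap_fderiv_le`), and near each point of Ω_M⁺ the map F is the graph over it,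
also beyond |w| = |z|, since there β = 1 (`approxMap_eventuallyEq`). -/

theorem iteratedFDeriv_add_two_apply {f : A → B} {n : ℕ} {x : A}
    (hf : ContDiffAt ℝ (n + 1 + 1 : ℕ) f x) (v : Fin (n + 1 + 1) → A) :
    iteratedFDeriv ℝ (n + 1 + 1) f x v =
      fderiv ℝ (fderiv ℝ (iteratedFDeriv ℝ n f)) x (v 0) (v 1) (Fin.tail (Fin.tail v)) := by
  have hd : DifferentiableAt ℝ (iteratedFDeriv ℝ (n + 1) f) x :=
    hf.differentiableAt_iteratedFDeriv (by exact_mod_cast Nat.lt_succ_self _)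
  have h2 : ContDiffAt ℝ 2 (iteratedFDeriv ℝ n f) x :=
    hf.iteratedFDeriv_right (by push_cast; rw [add_assoc, one_add_one_eq_two, add_comm])
  have h1 : DifferentiableAt ℝ (fderiv ℝ (iteratedFDeriv ℝ n f)) x :=
    (h2.fderiv_right (m := 1) (by norm_num [one_add_one_eq_two])).differentiableAt one_ne_zero
  rw [hd.iteratedFDeriv_succ_apply_left']
  have : (fun y => iteratedFDeriv ℝ (n + 1) f y (Fin.tail v)) =
      fun y => (fderiv ℝ (iteratedFDeriv ℝ n f) y (v 1)) (Fin.tail (Fin.tail v)) := by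
    ext y; rfl
  rw [this]
  have h3 : DifferentiableAt ℝ (fun y => fderiv ℝ (iteratedFDeriv ℝ n f) y (v 1)) x :=
    h1.clm_apply (differentiableAt_const _)
  rw [fderiv_continuousMultilinear_apply_const_apply h3,
    fderiv_clm_apply h1 (differentiableAt_const _)]
  simp

/-- The `n`-th derivative of a `C^n` function is symmetric. -/
theorem iteratedFDeriv_comp_perm_of_contDiffAt {f : A → B} {n : ℕ} :
    ∀ {x : A}, ContDiffAt ℝ n f x → ∀ (σ : Equiv.Perm (Fin n)) (v : Fin n → A),
      iteratedFDeriv ℝ n f x (v ∘ σ) = iteratedFDeriv ℝ n f x v := by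
  induction n with
  | zero => intro x _ σ v; congr 1; ext i; exact i.elim0
  | succ n ih =>
    intro x hf σ
    -- Adjacent transpositions generate the permutations as a monoid, so one swap at a time
    -- suffices.
    have hσ : σ ∈ Submonoid.closure
        (Set.range fun i : Fin n ↦ Equiv.swap i.castSucc i.succ) := by
      rw [Equiv.Perm.mclosure_swap_castSucc_succ]; trivial
    induction hσ using Submonoid.closure_induction with
    | one => intro v; rfl
    | mul σ τ _ _ h₁ h₂ =>
      intro v
      rw [Equiv.Perm.coe_mul, ← Function.comp_assoc, h₂, h₁]
    | mem σ hσ =>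
      obtain ⟨i, rfl⟩ := hσ
      intro v
      have hd : DifferentiableAt ℝ (iteratedFDeriv ℝ n f) x :=
        hf.differentiableAt_iteratedFDeriv (by exact_mod_cast Nat.lt_succ_self _)
      cases n with
      | zero => exact i.elim0
      | succ m =>
        -- Swapping the first two entries is the symmetry of the second derivative of D^m f. A later
        -- swap fixes entry 0 and is handled under the outermost derivative, by induction at all
        -- nearby points.
        induction i using Fin.cases with
        | zero =>
          rw [iteratedFDeriv_add_two_apply hf, iteratedFDeriv_add_two_apply hf]
          have h2 : ContDiffAt ℝ 2 (iteratedFDeriv ℝ m f) x :=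
            hf.iteratedFDeriv_right (by push_cast; rw [add_assoc, one_add_one_eq_two, add_comm])
          have hs := h2.isSymmSndFDerivAt (by simp)
          have ht : Fin.tail (Fin.tail (v ∘ Equiv.swap (Fin.castSucc (0 : Fin (m + 1))) (Fin.succ 0)))
              = Fin.tail (Fin.tail v) := by
            ext j
            simp only [Fin.tail, Function.comp]
            rw [Equiv.swap_apply_of_ne_of_ne]
            · simp [Fin.ext_iff]
            · simp [Fin.ext_iff]
          rw [ht]
          simp only [Function.comp]
          rw [show Equiv.swap (Fin.castSucc (0 : Fin (m + 1))) (Fin.succ 0) 0 = 1 from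
              Equiv.swap_apply_left _ _,
            show Equiv.swap (Fin.castSucc (0 : Fin (m + 1))) (Fin.succ 0) 1 = 0 from
              Equiv.swap_apply_right _ _, hs.eq]
        | succ j =>
          rw [hd.iteratedFDeriv_succ_apply_left', hd.iteratedFDeriv_succ_apply_left']
          have h0 : (v ∘ Equiv.swap (Fin.castSucc j.succ) (Fin.succ j.succ)) 0 = v 0 := by
            simp only [Function.comp]
            rw [Equiv.swap_apply_of_ne_of_ne]
            · simp [Fin.ext_iff]
            · simp [Fin.ext_iff]
          have ht : Fin.tail (v ∘ Equiv.swap (Fin.castSucc j.succ) (Fin.succ j.succ))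
              = Fin.tail v ∘ Equiv.swap (Fin.castSucc j) (Fin.succ j) := by
            ext k
            simp only [Fin.tail, Function.comp]
            congr 1
            rw [← Fin.succ_castSucc]
            exact ((Fin.succ_injective _).swap_apply _ _ _)
          rw [h0, ht]
          have hev : ∀ᶠ y in 𝓝 x, ContDiffAt ℝ (m + 1 : ℕ) f y :=
            (hf.of_le (by exact_mod_cast Nat.le_succ _)).eventually (by simp)
          have : (fun y => iteratedFDeriv ℝ (m + 1) f y
              (Fin.tail v ∘ Equiv.swap (Fin.castSucc j) (Fin.succ j))) =ᶠ[𝓝 x]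
              fun y => iteratedFDeriv ℝ (m + 1) f y (Fin.tail v) := by
            filter_upwards [hev] with y hy using ih hy _ _
          rw [this.fderiv_eq]

/-- A symmetric multilinear map which vanishes on the diagonal is zero. -/
theorem multilinear_eq_zero_of_diagonal {n : ℕ} {L : ContinuousMultilinearMap ℝ (fun _ : Fin n => A) B}
    (hs : ∀ (σ : Equiv.Perm (Fin n)) (v : Fin n → A), L (v ∘ σ) = L v)
    (h : ∀ y, L (fun _ => y) = 0) : L = 0 := by
  ext v
  -- The n-th derivative of the diagonal is the sum of L over all permutations of v, which symmetry
  -- turns into n! L v.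
  have h1 := L.iteratedFDeriv_comp_diagonal 0 v
  have h2 : (fun x => L (fun _ => x)) = fun _ => (0 : B) := funext h
  rw [h2] at h1
  have h3 : ∀ σ : Equiv.Perm (Fin n), L (fun i => v (σ i)) = L v := fun σ => hs σ v
  simp only [h3, Finset.sum_const, Finset.card_univ, Fintype.card_perm, Fintype.card_fin] at h1
  have h4 : iteratedFDeriv ℝ n (fun _ : A => (0 : B)) 0 = 0 := by
    rw [iteratedFDeriv_fun_zero]; rfl
  rw [h4] at h1
  have h5 : (n.factorial : ℝ) • L v = 0 := by
    rw [Nat.cast_smul_eq_nsmul]; exact h1.symm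
  exact (smul_eq_zero.mp h5).resolve_left (by exact_mod_cast n.factorial_ne_zero)

/-- If `h = O(|z|^{n+1})` at `0`, then the derivatives of `h` of order at most `n` vanish there. -/
theorem iteratedFDeriv_eq_zero_of_isBigO [CompleteSpace B] {h : A → B} {n : ℕ}
    (hc : ContDiffAt ℝ ∞ h 0) (hO : h =O[𝓝 0] fun z => ‖z‖ ^ (n + 1)) :
    ∀ k ≤ n, iteratedFDeriv ℝ k h 0 = 0 := by
  intro k
  induction k using Nat.strong_induction_on with
  | _ k ih =>
  intro hk
  have hck : ContDiffAt ℝ (k + 1 : ℕ) h 0 := hc.of_le (by exact_mod_cast le_top)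
  have hev : ∀ᶠ y in 𝓝 (0 : A), ContDiffAt ℝ (k + 1 : ℕ) h y := hck.eventually (by simp)
  have hcont : ContinuousAt (iteratedFDeriv ℝ (k + 1) h) 0 :=
    (hck.iteratedFDeriv_right (m := 0) (by simp)).continuousAt
  have hbd : ∀ᶠ y in 𝓝 (0 : A),
      ‖iteratedFDeriv ℝ (k + 1) h y‖ < ‖iteratedFDeriv ℝ (k + 1) h 0‖ + 1 :=
    hcont.norm.eventually_lt continuousAt_const (lt_add_one _)
  obtain ⟨ε, hε, hball⟩ := Metric.eventually_nhds_iff_ball.mp (hev.and hbd)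
  refine multilinear_eq_zero_of_diagonal
    (fun σ v => iteratedFDeriv_comp_perm_of_contDiffAt (hck.of_le (by exact_mod_cast Nat.le_succ k)) σ v) ?_
  -- A homogeneous polynomial of degree k which is O(|y|^{k+1}) vanishes. By Taylor's formula and
  -- the vanishing of the lower terms, the polynomial D^k h(0) is k! times the difference of h and
  -- an integral remainder, both of that order.
  apply Asymptotics.IsBigO.continuousMultilinearMap_apply_eq_zero
  set C := ‖iteratedFDeriv ℝ (k + 1) h 0‖ + 1
  have hrem : (fun y : A => ∫ t in (0 : ℝ)..1, (1 - t) ^ k •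
      iteratedFDeriv ℝ (k + 1) h (0 + t • y) (fun _ => y)) =O[𝓝 0] fun y => ‖y‖ ^ (k + 1) := by
    refine IsBigO.of_bound C ?_
    filter_upwards [Metric.ball_mem_nhds (0 : A) hε] with y hy
    have := intervalIntegral.norm_integral_le_of_norm_le_const (a := (0 : ℝ)) (b := 1)
      (C := C * ‖y‖ ^ (k + 1)) (f := fun t : ℝ => (1 - t) ^ k •
      iteratedFDeriv ℝ (k + 1) h (0 + t • y) (fun _ => y)) ?_
    · simpa using this
    · intro t ht
      rw [uIoc_of_le zero_le_one] at ht
      have hty : 0 + t • y ∈ Metric.ball (0 : A) ε := by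
        rw [mem_ball_zero_iff] at hy ⊢
        rw [zero_add, norm_smul, Real.norm_of_nonneg ht.1.le]
        exact (mul_le_of_le_one_left (norm_nonneg _) ht.2).trans_lt hy
      rw [norm_smul, norm_pow, Real.norm_of_nonneg (by linarith [ht.2])]
      calc (1 - t) ^ k * ‖iteratedFDeriv ℝ (k + 1) h (0 + t • y) fun _ => y‖
          ≤ 1 * ‖iteratedFDeriv ℝ (k + 1) h (0 + t • y) fun _ => y‖ := by
            gcongr
            exact pow_le_one₀ (by linarith [ht.2]) (by linarith [ht.1])
        _ ≤ 1 * (‖iteratedFDeriv ℝ (k + 1) h (0 + t • y)‖ * ∏ _i : Fin (k + 1), ‖y‖) := by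
            gcongr; exact ContinuousMultilinearMap.le_opNorm _ _
        _ ≤ C * ‖y‖ ^ (k + 1) := by
            rw [one_mul, Finset.prod_const, Finset.card_univ, Fintype.card_fin]
            gcongr
            exact (hball _ hty).2.le
  have hO' : h =O[𝓝 0] fun z => ‖z‖ ^ (k + 1) := by
    refine hO.trans (IsBigO.of_bound 1 ?_)
    filter_upwards [Metric.ball_mem_nhds (0 : A) one_pos] with y hy
    rw [mem_ball_zero_iff] at hy
    rw [norm_pow, norm_pow, norm_norm, one_mul]
    exact pow_le_pow_of_le_one (norm_nonneg _) hy.le (by omega)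
  have heq : (fun y => iteratedFDeriv ℝ k h 0 fun _ => y) =ᶠ[𝓝 0] fun y =>
      (k.factorial : ℝ) • (h y - (k.factorial : ℝ)⁻¹ • ∫ t in (0 : ℝ)..1, (1 - t) ^ k •
      iteratedFDeriv ℝ (k + 1) h (0 + t • y) (fun _ => y)) := by
    filter_upwards [Metric.ball_mem_nhds (0 : A) hε] with y hy
    have hT := map_add_eq_sum_add_integral_iteratedFDeriv (f := h) (x := 0) (y := y) (n := k) ?_
    · rw [zero_add] at hT
      rw [Finset.sum_range_succ, Finset.sum_eq_zero, zero_add] at hT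
      · conv_rhs => rw [hT]
        rw [add_sub_cancel_right, smul_smul, mul_inv_cancel₀, one_smul]
        exact_mod_cast k.factorial_ne_zero
      · intro j hj
        rw [Finset.mem_range] at hj
        rw [ih j hj (by omega)]; simp
    · intro t ht
      refine (hball _ ?_).1
      rw [mem_ball_zero_iff] at hy ⊢
      rw [zero_add, norm_smul, Real.norm_of_nonneg ht.1]
      exact (mul_le_of_le_one_left (norm_nonneg _) ht.2).trans_lt hy
  exact heq.trans_isBigO ((hO'.sub (hrem.const_smul_left _)).const_smul_left _)

/-- A quantitative Taylor estimate: if the derivatives of `h` of order at most `n` vanish at `0` and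
the next one is bounded by `C` on a ball, then `D^k h` is at most `C |z|^{n+1-k}` there. -/
theorem norm_iteratedFDeriv_le_of_vanishing {h : A → B} {n : ℕ} {C r : ℝ}
    (hc : ∀ z ∈ Metric.closedBall (0 : A) r, ContDiffAt ℝ ∞ h z)
    (h0 : ∀ k ≤ n, iteratedFDeriv ℝ k h 0 = 0)
    (hb : ∀ z ∈ Metric.closedBall (0 : A) r, ‖iteratedFDeriv ℝ (n + 1) h z‖ ≤ C) :
    ∀ j ≤ n + 1, ∀ z ∈ Metric.closedBall (0 : A) r,
      ‖iteratedFDeriv ℝ (n + 1 - j) h z‖ ≤ C * ‖z‖ ^ j := by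
  intro j
  induction j with
  | zero => intro _ z hz; simpa using hb z hz
  | succ j ih =>
    intro hj z hz
    have hr : ‖z‖ ≤ r := by simpa using hz
    have hC : 0 ≤ C := (norm_nonneg _).trans (hb z hz)
    have hsub : Metric.closedBall (0 : A) ‖z‖ ⊆ Metric.closedBall 0 r :=
      Metric.closedBall_subset_closedBall hr
    -- On the ball of radius ‖z‖ the next derivative is at most C‖z‖^j, and the function vanishes at
    -- 0, so each step down in order gains one factor ‖z‖.
    have hmv := (convex_closedBall (0 : A) ‖z‖).norm_image_sub_le_of_norm_fderiv_le
      (f := iteratedFDeriv ℝ (n + 1 - (j + 1)) h) (𝕜 := ℝ) (C := C * ‖z‖ ^ j) (x := 0) (y := z)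
      (fun y hy => (hc y (hsub hy)).differentiableAt_iteratedFDeriv
        (WithTop.coe_lt_coe.mpr (ENat.natCast_lt_top _)))
      (fun y hy => by
        rw [norm_fderiv_iteratedFDeriv, show n + 1 - (j + 1) + 1 = n + 1 - j by omega]
        refine (ih (by omega) y (hsub hy)).trans ?_
        gcongr
        simpa using hy) (by simp) (by simp)
    rw [h0 _ (by omega), sub_zero, sub_zero] at hmv
    rw [pow_succ, ← mul_assoc]
    exact hmv

end Taylor


/-! ### Uniform bounds for compact families with contact of order s -/

section Family

variable {E : Type*} [NormedAddCommGroup E] [NormedSpace ℝ E]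

theorem contDiff_const_mul_pow (c : ℂ) (s : ℕ) : ContDiff ℝ ∞ fun z : ℂ => c * z ^ s :=
  contDiff_const.mul (contDiff_id.pow s)

theorem iteratedFDeriv_const_mul_pow_apply_one (c : ℂ) (s : ℕ) :
    iteratedFDeriv ℝ s (fun z : ℂ => c * z ^ s) 0 (fun _ => 1) = s.factorial * c := by
  have h := (c • ContinuousMultilinearMap.mkPiAlgebraFin ℝ s ℂ).iteratedFDeriv_comp_diagonal
    0 (fun _ => 1)
  have h2 : (fun x : ℂ => (c • ContinuousMultilinearMap.mkPiAlgebraFin ℝ s ℂ) (fun _ => x)) =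
      fun z => c * z ^ s := by
    ext z; simp [ContinuousMultilinearMap.mkPiAlgebraFin_apply]
  rw [h2] at h
  rw [h]
  simp [ContinuousMultilinearMap.mkPiAlgebraFin_apply, Fintype.card_perm]

/-- Near a contact point of order `s`, `f^x` differs from its leading term to order `s + 1`. -/
theorem HasContact.iteratedFDeriv_eq_zero {R : ℝ} (hR : 0 < R) {s : ℕ} {f : ℂ → E × ℂ} {p : E}
    {a : ℂ} (h : HasContact R s f p a) (hf : ContDiffOn ℝ ∞ f (Metric.ball 0 R)) :
    ∀ k ≤ s, iteratedFDeriv ℝ k (fun z => (f z).2 - a * z ^ s) 0 = 0 := by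
  refine iteratedFDeriv_eq_zero_of_isBigO ?_ ?_
  · exact (contDiffAt_snd.comp 0 (hf.contDiffAt (Metric.ball_mem_nhds 0 hR))).sub
      (contDiff_const_mul_pow a s).contDiffAt
  · refine h.leading.trans (IsBigO.of_bound 1 (Eventually.of_forall fun z => ?_))
    simp

/-- The derivative of order s of f^x - az^s vanishes at 0, and that of az^s in the direction 1 is s!
a. Expressing a by a derivative of f makes it continuous in the parameter. -/
theorem HasContact.leading_eq {R : ℝ} (hR : 0 < R) {s : ℕ} {f : ℂ → E × ℂ} {p : E}
    {a : ℂ} (h : HasContact R s f p a) (hf : ContDiffOn ℝ ∞ f (Metric.ball 0 R)) :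
    a = (s.factorial : ℂ)⁻¹ * (iteratedFDeriv ℝ s f 0 (fun _ => 1)).2 := by
  have h0 := h.iteratedFDeriv_eq_zero hR hf s le_rfl
  have hfa : ContDiffAt ℝ ∞ f 0 := hf.contDiffAt (Metric.ball_mem_nhds 0 hR)
  have h1 : ContDiffAt ℝ ∞ (fun z => (f z).2) 0 := contDiffAt_snd.comp 0 hfa
  have hs : ((s : ℕ) : WithTop ℕ∞) ≤ ∞ := by exact_mod_cast le_top
  rw [fun_iteratedFDeriv_sub_apply (h1.of_le hs)
    ((contDiff_const_mul_pow a s).contDiffAt.of_le hs)] at h0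
  have h2 := congrArg (fun L => L fun _ => (1 : ℂ)) h0
  have h3 : iteratedFDeriv ℝ s (fun z => (f z).2) 0 =
      (ContinuousLinearMap.snd ℝ E ℂ).compContinuousMultilinearMap (iteratedFDeriv ℝ s f 0) :=
    (ContinuousLinearMap.snd ℝ E ℂ).iteratedFDeriv_comp_left hfa hs
  simp only [sub_apply, iteratedFDeriv_const_mul_pow_apply_one,
    zero_apply, h3] at h2
  simp only [ContinuousLinearMap.compContinuousMultilinearMap_coe, Function.comp,
    ContinuousLinearMap.coe_snd'] at h2
  have h4 : (s.factorial : ℂ) ≠ 0 := by exact_mod_cast s.factorial_ne_zero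
  rw [sub_eq_zero.mp h2, inv_mul_cancel_left₀ h4]

/-- Uniform bounds on a family of maps which has contact of order `s` at `z = 0`. -/
structure ContactBounds (C : ℝ) (s : ℕ) (f : ℂ → E × ℂ) (p : E) (a : ℂ) : Prop where
  snd_sub : ∀ z, ‖z‖ ≤ 1 → ‖(f z).2 - a * z ^ s‖ ≤ C * ‖z‖ ^ (s + 1)
  fst_sub : ∀ z, ‖z‖ ≤ 1 → ‖(f z).1 - p‖ ≤ C * ‖z‖
  fderiv_le : ∀ z, ‖z‖ ≤ 1 → ∀ u, ‖fderiv ℝ f z u‖ ≤ C * ‖u‖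
  fderiv_snd_le : ∀ z, ‖z‖ ≤ 1 → ∀ u, ‖z‖ * ‖(fderiv ℝ f z u).2‖ ≤ C * ‖z‖ ^ s * ‖u‖
  le_leading : 1 ≤ C * ‖a‖
  leading_le : ‖a‖ ≤ C

variable {T : Type*} [TopologicalSpace T] [CompactSpace T]

theorem IsSmoothFamily.exists_iteratedFDeriv_le {R : ℝ} (hR : 1 < R) {f : T → ℂ → E × ℂ}
    (hf : IsSmoothFamily R f) (k : ℕ) :
    ∃ C, 0 ≤ C ∧ ∀ t, ∀ z : ℂ, ‖z‖ ≤ 1 → ‖iteratedFDeriv ℝ k (f t) z‖ ≤ C := by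
  have hK : IsCompact ((univ : Set T) ×ˢ Metric.closedBall (0 : ℂ) 1) :=
    isCompact_univ.prod (isCompact_closedBall 0 1)
  obtain ⟨C, hC⟩ := hK.exists_bound_of_continuousOn ((hf.cont k).mono
    (prod_mono le_rfl (Metric.closedBall_subset_ball hR)))
  exact ⟨max C 0, le_max_right _ _, fun t z hz =>
    (hC (t, z) ⟨trivial, by simpa using hz⟩).trans (le_max_left _ _)⟩

/-- The remainder f^x - az^s vanishes to order s at 0 and its derivative of order s + 1 is bounded
uniformly over the family, so the Taylor estimates are uniform. The coefficient a is continuous and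
nowhere zero on a compact space, hence bounded above and away from zero. -/
theorem exists_contactBounds {R : ℝ} (hR : 1 < R) {s : ℕ} (hs : 1 ≤ s) {f : T → ℂ → E × ℂ}
    {p : T → E} {a : T → ℂ} (hf : IsSmoothFamily R f) (h : ∀ t, HasContact R s (f t) (p t) (a t)) :
    ∃ C, 0 < C ∧ ∀ t, ContactBounds C s (f t) (p t) (a t) := by
  have hR0 : 0 < R := one_pos.trans hR
  have ha : Continuous a := by
    have h1 : Continuous fun t => iteratedFDeriv ℝ s (f t) 0 := by
      have := (hf.cont s).comp_continuous (f := fun t : T => (t, (0 : ℂ))) (by fun_prop)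
        (fun t => ⟨trivial, Metric.mem_ball_self hR0⟩)
      exact this
    have h2 : a = fun t => (s.factorial : ℂ)⁻¹ * (iteratedFDeriv ℝ s (f t) 0 (fun _ => 1)).2 :=
      funext fun t => (h t).leading_eq hR0 (hf.smooth t)
    rw [h2]
    have h3 : Continuous fun t => iteratedFDeriv ℝ s (f t) 0 (fun _ => 1) :=
      (ContinuousMultilinearMap.apply ℝ (fun _ : Fin s => ℂ) (E × ℂ) (fun _ => 1)).continuous.comp h1
    exact continuous_const.mul (continuous_snd.comp h3)
  obtain ⟨A, hA⟩ := isCompact_univ.exists_bound_of_continuousOn ha.continuousOn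
  obtain ⟨A', hA'⟩ := isCompact_univ.exists_bound_of_continuousOn
    (ha.inv₀ fun t => (h t).ne_zero).continuousOn
  obtain ⟨C₁, hC₁, hb₁⟩ := hf.exists_iteratedFDeriv_le hR 1
  obtain ⟨C₂, hC₂, hb₂⟩ := hf.exists_iteratedFDeriv_le hR (s + 1)
  have hP : ContDiff ℝ ∞ fun z : ℂ => z ^ s := contDiff_id.pow s
  obtain ⟨P, hP'⟩ := (isCompact_closedBall (0 : ℂ) 1).exists_bound_of_continuousOn
    (hP.continuous_iteratedFDeriv (m := s + 1) (by exact_mod_cast le_top)).continuousOn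
  set A₀ := max A 0
  have hAt : ∀ t, ‖a t‖ ≤ A₀ := fun t => (hA t trivial).trans (le_max_left _ _)
  set D := C₂ + A₀ * P
  have hP0 : 0 ≤ P := (norm_nonneg _).trans (hP' 0 (by simp))
  have hA0 : 0 ≤ A₀ := le_max_right _ _
  have hD : 0 ≤ D := by positivity
  -- C₁ bounds Df, D bounds the derivative of order s + 1 of the remainder, A₀(s + 1) covers |a| and
  -- the factor s|a| in the derivative of az^s, |A'| covers 1/|a|, and 1 gives positivity.
  refine ⟨C₁ + D + A₀ * (s + 1) + |A'| + 1 , by positivity, fun t => ?_⟩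
  set C := C₁ + D + A₀ * (s + 1) + |A'| + 1
  have hs1 : (0 : ℝ) ≤ A₀ * (s + 1) := by positivity
  have hA'0 := abs_nonneg A'
  have hC1 : C₁ ≤ C := by simp only [C]; linarith
  have hCD : D ≤ C := by simp only [C]; linarith
  have hCA : A₀ ≤ C := by
    have : A₀ * 1 ≤ A₀ * (s + 1) := by gcongr; linarith [(Nat.cast_nonneg s : (0 : ℝ) ≤ s)]
    simp only [C]; linarith
  have hfa : ∀ z : ℂ, ‖z‖ ≤ 1 → ContDiffAt ℝ ∞ (f t) z := fun z hz =>
    (hf.smooth t).contDiffAt (Metric.isOpen_ball.mem_nhds (by simpa using hz.trans_lt hR))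
  have hfd : ∀ z : ℂ, ‖z‖ ≤ 1 → DifferentiableAt ℝ (f t) z := fun z hz =>
    (hfa z hz).differentiableAt (by simp)
  have hfn : ∀ z : ℂ, ‖z‖ ≤ 1 → ‖fderiv ℝ (f t) z‖ ≤ C₁ := fun z hz => by
    rw [← norm_iteratedFDeriv_one]; exact hb₁ t z hz
  have hr : ∀ z : ℂ, ‖z‖ ≤ 1 → ContDiffAt ℝ ∞ (fun z => (f t z).2 - a t * z ^ s) z := fun z hz =>
    (contDiffAt_snd.comp z (hfa z hz)).sub (contDiff_const_mul_pow (a t) s).contDiffAt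
  have hvan := norm_iteratedFDeriv_le_of_vanishing (h := fun z => (f t z).2 - a t * z ^ s) (n := s)
    (C := D) (r := 1) (fun z hz => hr z (by simpa using hz))
    ((h t).iteratedFDeriv_eq_zero hR0 (hf.smooth t)) (fun z hz => by
      have hz' : ‖z‖ ≤ 1 := by simpa using hz
      have hle : ((s + 1 : ℕ) : WithTop ℕ∞) ≤ ∞ := by exact_mod_cast le_top
      have hx : ContDiffAt ℝ ∞ (fun z => (f t z).2) z := contDiffAt_snd.comp z (hfa z hz')
      rw [fun_iteratedFDeriv_sub_apply (hx.of_le hle)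
        ((contDiff_const_mul_pow (a t) s).contDiffAt.of_le hle)]
      refine (norm_sub_le _ _).trans (add_le_add ?_ ?_)
      · refine ((ContinuousLinearMap.snd ℝ E ℂ).norm_iteratedFDeriv_comp_left (hfa z hz') hle).trans ?_
        calc _ ≤ 1 * C₂ := by
              gcongr
              · exact ContinuousLinearMap.norm_snd_le ..
              · exact hb₂ t z hz'
          _ = C₂ := one_mul _
      · have : (fun z : ℂ => a t * z ^ s) = fun z => a t • z ^ s := rfl
        rw [this, iteratedFDeriv_const_smul_apply' (hP.contDiffAt.of_le hle), norm_smul]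
        gcongr
        · exact hAt t
        · exact hP' z hz)
  constructor
  · intro z hz
    have := hvan (s + 1) le_rfl z (by simpa using hz)
    rw [Nat.sub_self, norm_iteratedFDeriv_zero] at this
    exact this.trans (by gcongr)
  · intro z hz
    have hmv := (convex_closedBall (0 : ℂ) 1).norm_image_sub_le_of_norm_fderiv_le
      (f := f t) (𝕜 := ℝ) (C := C₁) (x := 0) (y := z)
      (fun y hy => hfd y (by simpa using hy)) (fun y hy => hfn y (by simpa using hy)) (by simp)
      (by simpa using hz)
    rw [(h t).zero, sub_zero] at hmv
    calc ‖(f t z).1 - p t‖ ≤ ‖f t z - (p t, 0)‖ := norm_fst_le (f t z - (p t, 0))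
      _ ≤ C₁ * ‖z‖ := hmv
      _ ≤ C * ‖z‖ := by gcongr
  · intro z hz u
    exact (ContinuousLinearMap.le_opNorm _ _).trans (by gcongr; exact (hfn z hz).trans hC1)
  · intro z hz u
    have h1 := hvan s (Nat.le_succ s) z (by simpa using hz)
    rw [show s + 1 - s = 1 by omega, norm_iteratedFDeriv_one] at h1
    have hq : HasFDerivAt (fun z : ℂ => a t * z ^ s)
        ((a t) • ((s * z ^ (s - 1)) • (1 : ℂ →L[ℂ] ℂ)).restrictScalars ℝ) z := by
      have := ((hasDerivAt_pow s z).hasFDerivAt.restrictScalars ℝ).const_mul (a t)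
      refine this.congr_fderiv ?_
      ext x
      simp [mul_comm]
    have hsn : HasFDerivAt (fun z => (f t z).2)
        ((ContinuousLinearMap.snd ℝ E ℂ).comp (fderiv ℝ (f t) z)) z :=
      (ContinuousLinearMap.snd ℝ E ℂ).hasFDerivAt.comp z (hfd z hz).hasFDerivAt
    rw [(hsn.fun_sub hq).fderiv] at h1
    have h2 : (fderiv ℝ (f t) z u).2 = ((ContinuousLinearMap.snd ℝ E ℂ).comp (fderiv ℝ (f t) z) -
        (a t) • ((s * z ^ (s - 1)) • (1 : ℂ →L[ℂ] ℂ)).restrictScalars ℝ) u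
        + a t * (s * z ^ (s - 1) * u) := by
      simp
    rw [h2]
    have h3 := (ContinuousLinearMap.le_of_opNorm_le _ h1 u)
    -- The factor ‖z‖ raises the z^{s-1} in the derivative of z^s to z^s; this needs s ≥ 1.
    have hzs : ‖z‖ ^ s = ‖z‖ * ‖z‖ ^ (s - 1) := by rw [← pow_succ']; congr 1; omega
    calc ‖z‖ * ‖_‖ ≤ ‖z‖ * (D * ‖z‖ ^ s * ‖u‖ + A₀ * (s * ‖z‖ ^ (s - 1) * ‖u‖)) := by
          gcongr
          refine (norm_add_le _ _).trans (add_le_add h3 ?_)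
          rw [norm_mul, norm_mul, norm_mul, norm_pow, Complex.norm_natCast]
          gcongr
          exact hAt t
      _ = (D * ‖z‖ + A₀ * s) * ‖z‖ ^ s * ‖u‖ := by rw [hzs]; ring
      _ ≤ C * ‖z‖ ^ s * ‖u‖ := by
          gcongr
          have : D * ‖z‖ ≤ D := mul_le_of_le_one_right hD hz
          simp only [C]
          linarith
  · have h1 : ‖(a t)⁻¹‖ ≤ C := (hA' t trivial).trans ((le_abs_self _).trans (by
      simp only [C]; linarith))
    have hpos : 0 < ‖a t‖ := norm_pos_iff.mpr (h t).ne_zero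
    rw [norm_inv] at h1
    calc 1 = ‖a t‖⁻¹ * ‖a t‖ := (inv_mul_cancel₀ hpos.ne').symm
      _ ≤ C * ‖a t‖ := by gcongr
  · exact (hAt t).trans hCA

/-- Away from the contact point, `f^x` is uniformly bounded below. -/
theorem exists_le_norm_snd {R : ℝ} (hR : 1 < R) {s : ℕ} {f : T → ℂ → E × ℂ}
    {p : T → E} {a : T → ℂ} (hf : IsSmoothFamily R f) (h : ∀ t, HasContact R s (f t) (p t) (a t))
    {δ : ℝ} (hδ : 0 < δ) :
    ∃ c > 0, ∀ t, ∀ z : ℂ, δ ≤ ‖z‖ → ‖z‖ ≤ 1 → c ≤ ‖(f t z).2‖ := by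
  have hK : IsCompact ((univ : Set T) ×ˢ (Metric.closedBall (0 : ℂ) 1 ∩ {z | δ ≤ ‖z‖})) :=
    isCompact_univ.prod ((isCompact_closedBall 0 1).inter_right
      (isClosed_le continuous_const continuous_norm))
  have hc : ContinuousOn (fun q : T × ℂ => (f q.1 q.2).2) (univ ×ˢ Metric.ball 0 R) := by
    have h0 := (ContinuousMultilinearMap.apply ℝ (fun _ : Fin 0 => ℂ) (E × ℂ)
      (fun _ => 1)).continuous.comp_continuousOn (hf.cont 0)
    exact continuous_snd.comp_continuousOn h0
  have hsub : ((univ : Set T) ×ˢ (Metric.closedBall (0 : ℂ) 1 ∩ {z | δ ≤ ‖z‖})) ⊆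
      univ ×ˢ Metric.ball 0 R :=
    prod_mono le_rfl (inter_subset_left.trans (Metric.closedBall_subset_ball hR))
  have hne : ∀ q ∈ ((univ : Set T) ×ˢ (Metric.closedBall (0 : ℂ) 1 ∩ {z | δ ≤ ‖z‖})),
      (f q.1 q.2).2 ≠ 0 := fun q hq => (h q.1).only q.2 (hsub hq).2 (by
        rintro h0
        have : δ ≤ ‖q.2‖ := hq.2.2
        rw [h0, norm_zero] at this
        linarith)
  obtain ⟨C, hC⟩ := hK.exists_bound_of_continuousOn ((hc.mono hsub).inv₀ hne)
  -- The maximum with 1 keeps the constant positive even if the compact set is empty.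
  refine ⟨(max C 1)⁻¹, by positivity, fun t z h1 h2 => ?_⟩
  have hm : (t, z) ∈ ((univ : Set T) ×ˢ (Metric.closedBall (0 : ℂ) 1 ∩ {z | δ ≤ ‖z‖})) :=
    ⟨trivial, by simpa using h2, h1⟩
  have h3 := (hC (t, z) hm).trans (le_max_left C 1)
  change ‖((f t z).2)⁻¹‖ ≤ _ at h3
  have hpos : 0 < ‖(f t z).2‖ := norm_pos_iff.mpr (hne _ hm)
  rw [norm_inv] at h3
  exact inv_le_of_inv_le₀ hpos h3

end Family


/-! ### Christoffel symbols of coercive and of induced metrics -/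

section Christoffel

variable {W W' : Type*} [NormedAddCommGroup W] [NormedSpace ℝ W]
  [NormedAddCommGroup W'] [NormedSpace ℝ W']

/-- Coercivity gives injectivity, and W and its dual have equal dimension. Invertibility matters
because `ContinuousLinearMap.inverse` is zero by default on maps that are not invertible. -/
theorem exists_equiv_of_coercive [FiniteDimensional ℝ W] {G : W →L[ℝ] W →L[ℝ] ℝ} {c : ℝ}
    (hc : 0 < c) (hG : ∀ u, c * ‖u‖ ^ 2 ≤ G u u) : ∃ e : W ≃L[ℝ] (W →L[ℝ] ℝ), ↑e = G := by
  have hinj : Function.Injective (G : W →ₗ[ℝ] (W →L[ℝ] ℝ)) := by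
    rw [injective_iff_map_eq_zero]
    intro u hu
    have h1 := hG u
    have h2 : G u = 0 := hu
    rw [h2, zero_apply] at h1
    have h3 : ‖u‖ ^ 2 ≤ 0 := by
      by_contra h; push Not at h; have := mul_pos hc h; linarith
    have h4 : ‖u‖ = 0 := pow_eq_zero_iff two_ne_zero |>.mp (le_antisymm h3 (by positivity))
    exact norm_eq_zero.mp h4
  have hdim : Module.finrank ℝ W = Module.finrank ℝ (W →L[ℝ] ℝ) := by
    rw [← (LinearMap.toContinuousLinearMap : (W →ₗ[ℝ] ℝ) ≃ₗ[ℝ] _).finrank_eq]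
    exact (Subspace.dual_finrank_eq (K := ℝ) (V := W)).symm
  let e := LinearEquiv.ofInjectiveOfFinrankEq (G : W →ₗ[ℝ] (W →L[ℝ] ℝ)) hinj hdim
  refine ⟨e.toContinuousLinearEquiv, ?_⟩
  ext u
  rfl

/-- The solution x of G x = φ is tested on itself: c‖x‖² ≤ φ(x) ≤ D‖x‖. -/
theorem norm_inverse_le_of_coercive [FiniteDimensional ℝ W] {G : W →L[ℝ] W →L[ℝ] ℝ} {c : ℝ}
    (hc : 0 < c) (hG : ∀ u, c * ‖u‖ ^ 2 ≤ G u u) {φ : W →L[ℝ] ℝ} {D : ℝ} (hD : 0 ≤ D)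
    (hφ : ∀ w, |φ w| ≤ D * ‖w‖) : ‖G.inverse φ‖ ≤ D / c := by
  obtain ⟨e, rfl⟩ := exists_equiv_of_coercive hc hG
  rw [ContinuousLinearMap.inverse_equiv]
  set x := e.symm φ
  have h1 : c * ‖x‖ ^ 2 ≤ φ x := by
    have := hG x
    rwa [show (e : W →L[ℝ] (W →L[ℝ] ℝ)) x = φ from e.apply_symm_apply φ] at this
  have h2 := (le_abs_self _).trans (hφ x)
  change ‖x‖ ≤ D / c
  rcases (norm_nonneg x).eq_or_lt with h | h
  · rw [← h]; positivity
  · rw [le_div_iff₀ hc]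
    have : ‖x‖ * (‖x‖ * c) ≤ ‖x‖ * D := by linarith
    exact le_of_mul_le_mul_left this h

/-- A bound on the Christoffel symbols. -/
theorem norm_christoffel_le [FiniteDimensional ℝ W] {G : W → W →L[ℝ] W →L[ℝ] ℝ} {q : W} {c : ℝ}
    (hc : 0 < c) (hG : ∀ u, c * ‖u‖ ^ 2 ≤ G q u u) {u v : W} {D : ℝ} (hD : 0 ≤ D)
    (h : ∀ w, |fderiv ℝ G q u v w + fderiv ℝ G q v u w - fderiv ℝ G q w u v| ≤ D * ‖w‖) :
    ‖christoffel G q u v‖ ≤ D / c := by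
  refine norm_inverse_le_of_coercive hc hG hD fun w => ?_
  have h0 := abs_nonneg (fderiv ℝ G q u v w + fderiv ℝ G q v u w - fderiv ℝ G q w u v)
  have := h w
  simp only [smul_apply, add_apply, sub_apply, ContinuousLinearMap.flip_apply, smul_eq_mul,
    abs_mul]
  norm_num
  linarith

/-- The derivative of the metric induced by `G` through a map whose differential is `L`. -/
theorem hasFDerivAt_bilinearComp {G : W → W →L[ℝ] W →L[ℝ] ℝ} {i : W' → W} {L : W' → W' →L[ℝ] W}
    {q : W'} {L' : W' →L[ℝ] W' →L[ℝ] W}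
    (hG : DifferentiableAt ℝ G (i q)) (hi : HasFDerivAt i (L q) q) (hL : HasFDerivAt L L' q)
    (u v w : W') :
    fderiv ℝ (fun q => (G (i q)).bilinearComp (L q) (L q)) q u v w =
      fderiv ℝ G (i q) (L q u) (L q v) (L q w) + G (i q) (L' u v) (L q w)
        + G (i q) (L q v) (L' u w) := by
  have hGi : HasFDerivAt (fun q => G (i q)) ((fderiv ℝ G (i q)).comp (L q)) q :=
    HasFDerivAt.comp (g := G) (f := i) q hG.hasFDerivAt hi
  have hfun : (fun q => (G (i q)).bilinearComp (L q) (L q)) =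
      fun q => ((ContinuousLinearMap.compL ℝ W' W ℝ).flip (L q)).comp ((G (i q)).comp (L q)) := by
    ext q v w; rfl
  have hd : DifferentiableAt ℝ (fun q => (G (i q)).bilinearComp (L q) (L q)) q := by
    rw [hfun]
    exact (((ContinuousLinearMap.compL ℝ W' W ℝ).flip.differentiableAt).comp q
      hL.differentiableAt).clm_comp (hGi.differentiableAt.clm_comp hL.differentiableAt)
  -- Both expressions are the derivative of the same scalar function, with v and w frozen.
  have h1 : HasFDerivAt (fun q => (G (i q)).bilinearComp (L q) (L q) v w)
      ((fderiv ℝ (fun q => (G (i q)).bilinearComp (L q) (L q)) q).flip v |>.flip w) q := by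
    have := (hd.hasFDerivAt.clm_apply (hasFDerivAt_const v q)).clm_apply (hasFDerivAt_const w q)
    refine this.congr_fderiv ?_
    ext x; simp
  have h2 : HasFDerivAt (fun q => (G (i q)).bilinearComp (L q) (L q) v w)
      _ q := (hGi.clm_apply (hL.clm_apply (hasFDerivAt_const v q))).clm_apply
        (hL.clm_apply (hasFDerivAt_const w q))
  have h3 := congrArg (fun A => A u) (h1.unique h2)
  simp only [ContinuousLinearMap.flip_apply] at h3
  rw [h3]
  simp
  ring

end Christoffel

/-! ### The graph y = λ/x: lift of tangent vectors and its derivative -/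

section Lift

variable {E : Type*} [NormedAddCommGroup E] [NormedSpace ℝ E]

/-- The map `m ↦ (v ↦ (0, 0, m v^x))`. -/
def slopeMap : ℂ →L[ℝ] (E × ℂ) →L[ℝ] E × ℂ × ℂ :=
  (ContinuousLinearMap.compL ℝ (E × ℂ) ℂ (E × ℂ × ℂ)
    ((ContinuousLinearMap.inr ℝ E (ℂ × ℂ)).comp (ContinuousLinearMap.inr ℝ ℂ ℂ))).comp
    (((ContinuousLinearMap.compL ℝ (E × ℂ) ℂ ℂ).flip (ContinuousLinearMap.snd ℝ E ℂ)).comp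
      (ContinuousLinearMap.mul ℝ ℂ))

@[simp] theorem slopeMap_apply (m : ℂ) (v : E × ℂ) : slopeMap m v = (0, 0, m * v.2) := rfl

/-- The lift `(v, x) ↦ (v, x, m x)` of tangent vectors. -/
def liftMap (m : ℂ) : (E × ℂ) →L[ℝ] E × ℂ × ℂ := xIncl + slopeMap m

@[simp] theorem liftMap_apply (m : ℂ) (v : E × ℂ) : liftMap m v = (v.1, v.2, m * v.2) := by
  simp [liftMap, xIncl]

@[simp] theorem proj_apply (u : E × ℂ × ℂ) : proj u = (u.1, u.2.1) := rfl

@[simp] theorem xIncl_apply (u : E × ℂ) : xIncl u = (u.1, u.2, 0) := rfl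

theorem norm_liftMap_apply_le (m : ℂ) (v : E × ℂ) : ‖liftMap m v‖ ≤ (1 + ‖m‖) * ‖v‖ := by
  rw [liftMap_apply]
  have h1 := norm_fst_le v
  have h2 := norm_snd_le v
  have hm := norm_nonneg m
  have hv := norm_nonneg v
  refine norm_prod_le_iff.mpr ⟨by simp only; nlinarith, norm_prod_le_iff.mpr
    ⟨by simp only; nlinarith, ?_⟩⟩
  simp only [norm_mul]
  nlinarith [mul_le_mul_of_nonneg_left h2 hm]

theorem norm_le_norm_liftMap_apply (m : ℂ) (v : E × ℂ) : ‖v‖ ≤ ‖liftMap m v‖ := by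
  rw [liftMap_apply]
  refine norm_prod_le_iff.mpr ⟨norm_fst_le (v.1, v.2, m * v.2), ?_⟩
  exact (norm_fst_le (v.2, m * v.2)).trans (norm_snd_le (v.1, v.2, m * v.2))

theorem hasFDerivAt_fiberIncl (lam : ℂ) {q : E × ℂ} (hq : q.2 ≠ 0) :
    HasFDerivAt (fiberIncl lam) (liftMap (-lam / q.2 ^ 2)) q := by
  have h1 : HasFDerivAt (fun x : ℂ => lam / x)
      (((1 : ℂ →L[ℂ] ℂ).smulRight (-lam / q.2 ^ 2)).restrictScalars ℝ) q.2 := by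
    have := ((hasDerivAt_inv hq).const_mul lam).hasFDerivAt.restrictScalars ℝ
    refine HasFDerivAt.congr_fderiv (f := fun x : ℂ => lam / x) (this.congr_of_eventuallyEq ?_) ?_
    · exact Eventually.of_forall fun x => div_eq_mul_inv _ _
    · ext x
      simp
      ring
  have h2 : HasFDerivAt (fun q : E × ℂ => (q.1, q.2, lam / q.2)) _ q :=
    (hasFDerivAt_fst).prodMk ((hasFDerivAt_snd).prodMk (h1.comp q hasFDerivAt_snd))
  refine h2.congr_fderiv ?_
  refine ContinuousLinearMap.ext fun u => ?_
  simp [mul_comm]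

theorem fderiv_fiberIncl (lam : ℂ) {q : E × ℂ} (hq : q.2 ≠ 0) :
    fderiv ℝ (fiberIncl lam) q = liftMap (-lam / q.2 ^ 2) := (hasFDerivAt_fiberIncl lam hq).fderiv

/-- The second derivative of the inclusion of the fiber. -/
def liftDeriv (lam : ℂ) (q : E × ℂ) : (E × ℂ) →L[ℝ] (E × ℂ) →L[ℝ] E × ℂ × ℂ :=
  slopeMap.comp ((ContinuousLinearMap.mul ℝ ℂ (2 * lam / q.2 ^ 3)).comp
    (ContinuousLinearMap.snd ℝ E ℂ))

@[simp] theorem liftDeriv_apply (lam : ℂ) (q u v : E × ℂ) :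
    liftDeriv lam q u v = (0, 0, 2 * lam / q.2 ^ 3 * u.2 * v.2) := rfl

theorem liftDeriv_comm (lam : ℂ) (q u v : E × ℂ) :
    liftDeriv lam q u v = liftDeriv lam q v u := by
  simp only [liftDeriv_apply, mul_right_comm]

/-- Since λ/x³ is the slope divided by x up to sign, a bounded slope leaves only the pole of the
logarithmic derivative u^x/x. -/
theorem norm_liftDeriv_apply_le (lam : ℂ) {q : E × ℂ} (hq : q.2 ≠ 0) (u v : E × ℂ) :
    ‖liftDeriv lam q u v‖ ≤ 2 * ‖-lam / q.2 ^ 2‖ * (‖u.2‖ / ‖q.2‖) * ‖v‖ := by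
  have h : ‖liftDeriv lam q u v‖ = 2 * ‖-lam / q.2 ^ 2‖ * (‖u.2‖ / ‖q.2‖) * ‖v.2‖ := by
    have hq' := norm_ne_zero_iff.mpr hq
    rw [liftDeriv_apply, Prod.norm_mk, Prod.norm_mk]
    simp only [norm_zero, norm_mul, norm_div, norm_pow, norm_neg, Complex.norm_ofNat]
    rw [max_eq_right (by positivity), max_eq_right (by positivity)]
    field_simp
  rw [h]
  gcongr
  exact norm_snd_le v

theorem hasFDerivAt_liftMap (lam : ℂ) {q : E × ℂ} (hq : q.2 ≠ 0) :
    HasFDerivAt (fun q : E × ℂ => (liftMap (-lam / q.2 ^ 2) : (E × ℂ) →L[ℝ] E × ℂ × ℂ))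
      (liftDeriv lam q) q := by
  have h1 : HasFDerivAt (fun x : ℂ => -lam / x ^ 2)
      (ContinuousLinearMap.mul ℝ ℂ (2 * lam / q.2 ^ 3)) q.2 := by
    have := ((((hasDerivAt_pow 2 q.2).fun_inv (pow_ne_zero 2 hq)).const_mul
      (-lam)).hasFDerivAt.restrictScalars ℝ)
    refine HasFDerivAt.congr_fderiv (f := fun x : ℂ => -lam / x ^ 2) (this.congr_of_eventuallyEq ?_) ?_
    · exact Eventually.of_forall fun x => div_eq_mul_inv _ _
    · ext x
      simp
      field_simp
  have h2 : HasFDerivAt (fun q : E × ℂ => -lam / q.2 ^ 2)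
      ((ContinuousLinearMap.mul ℝ ℂ (2 * lam / q.2 ^ 3)).comp (ContinuousLinearMap.snd ℝ E ℂ)) q :=
    HasFDerivAt.comp (g := fun x : ℂ => -lam / x ^ 2) (f := Prod.snd) q h1 hasFDerivAt_snd
  have h3 : HasFDerivAt (fun q : E × ℂ => (slopeMap (-lam / q.2 ^ 2) : (E × ℂ) →L[ℝ] E × ℂ × ℂ))
      (liftDeriv lam q) q :=
    HasFDerivAt.comp (g := slopeMap (E := E)) (f := fun q : E × ℂ => -lam / q.2 ^ 2) q
      (slopeMap (E := E)).hasFDerivAt h2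
  exact h3.const_add xIncl

end Lift

set_option maxSynthPendingDepth 3


/-! ### The cylindrical metric -/

section Cylinder

/-- The numerator 1 + |μ/z²|² is ρ²/|z|², so μ drops out. Norms on C₁ and on C_μ therefore carry the
same weight. -/
theorem cylDensity_eq (mu : ℂ) {z : ℂ} (hz : z ≠ 0) : cylDensity mu z = (‖z‖ ^ 2)⁻¹ := by
  have h : 0 < ‖z‖ := norm_pos_iff.mpr hz
  unfold cylDensity rho
  rw [Real.sq_sqrt (by positivity), norm_div, norm_div, norm_pow]
  have : ‖z‖ ^ 2 + (‖mu‖ / ‖z‖) ^ 2 ≠ 0 := by positivity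
  field_simp

theorem hasFDerivAt_inv_norm_sq {z : ℂ} (hz : z ≠ 0) :
    HasFDerivAt (fun z : ℂ => (‖z‖ ^ 2)⁻¹) (-((‖z‖ ^ 2) ^ 2)⁻¹ • (2 • innerSL ℝ z)) z := by
  have h : ‖z‖ ^ 2 ≠ 0 := pow_ne_zero 2 (norm_ne_zero_iff.mpr hz)
  exact (hasDerivAt_inv h).comp_hasFDerivAt z (hasStrictFDerivAt_norm_sq z).hasFDerivAt

/-- The Christoffel symbols of the cylindrical metric. -/
theorem norm_christoffel_cylMetric_le (mu : ℂ) {z : ℂ} (hz : z ≠ 0) (u v : ℂ) :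
    ‖z‖ * ‖christoffel (cylMetric mu) z u v‖ ≤ 6 * ‖u‖ * ‖v‖ := by
  have hpos : 0 < ‖z‖ := norm_pos_iff.mpr hz
  set m₀ : ℂ →L[ℝ] ℂ →L[ℝ] ℝ :=
    Complex.reCLM.smulRight Complex.reCLM + Complex.imCLM.smulRight Complex.imCLM with hm₀
  have hm : ∀ u v : ℂ, m₀ u v = inner ℝ u v := by
    intro u v
    rw [hm₀, Complex.inner]
    simp
    ring
  have hG : cylMetric mu =ᶠ[𝓝 z] fun z => (‖z‖ ^ 2)⁻¹ • m₀ := by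
    filter_upwards [isOpen_ne.mem_nhds hz] with y hy
    rw [cylMetric, cylDensity_eq mu hy]
  have hd₀ : HasFDerivAt (fun z : ℂ => (‖z‖ ^ 2)⁻¹ • m₀) ((ContinuousLinearMap.toSpanSingleton ℝ m₀).comp
      (-((‖z‖ ^ 2) ^ 2)⁻¹ • (2 • innerSL ℝ z))) z :=
    HasFDerivAt.comp (g := ContinuousLinearMap.toSpanSingleton ℝ m₀)
      (f := fun z : ℂ => (‖z‖ ^ 2)⁻¹) z (ContinuousLinearMap.toSpanSingleton ℝ m₀).hasFDerivAt
      (hasFDerivAt_inv_norm_sq hz)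
  have hd := hG.fderiv_eq.trans hd₀.fderiv
  have hb : ∀ u v w : ℂ, |fderiv ℝ (cylMetric mu) z u v w| ≤ 2 * ‖u‖ * ‖v‖ * ‖w‖ / ‖z‖ ^ 3 := by
    intro u v w
    rw [hd]
    simp only [ContinuousLinearMap.comp_apply, ContinuousLinearMap.toSpanSingleton_apply,
      smul_apply, hm, smul_eq_mul, innerSL_apply_apply,
      nsmul_eq_mul, abs_mul, abs_neg, abs_inv, abs_pow, abs_norm, Nat.cast_ofNat, Nat.abs_ofNat]
    have h1 := abs_real_inner_le_norm z u
    have h2 := abs_real_inner_le_norm v w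
    calc ((‖z‖ ^ 2) ^ 2)⁻¹ * (2 * |inner ℝ z u|) * |inner ℝ v w|
        ≤ ((‖z‖ ^ 2) ^ 2)⁻¹ * (2 * (‖z‖ * ‖u‖)) * (‖v‖ * ‖w‖) := by gcongr
      _ = 2 * ‖u‖ * ‖v‖ * ‖w‖ / ‖z‖ ^ 3 := by field_simp
  have hc : 0 < (‖z‖ ^ 2)⁻¹ := by positivity
  -- Each of the three derivatives of the metric contributes 2/‖z‖³, and the coercivity constant
  -- ‖z‖⁻² reduces the total to order 1/‖z‖.
  have := norm_christoffel_le (G := cylMetric mu) (q := z) hc (fun u => ?_) (u := u) (v := v)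
    (D := 6 * ‖u‖ * ‖v‖ / ‖z‖ ^ 3) (by positivity) (fun w => ?_)
  · calc ‖z‖ * ‖christoffel (cylMetric mu) z u v‖
        ≤ ‖z‖ * (6 * ‖u‖ * ‖v‖ / ‖z‖ ^ 3 / (‖z‖ ^ 2)⁻¹) := by gcongr
      _ = 6 * ‖u‖ * ‖v‖ := by field_simp
  · rw [hG.eq_of_nhds, smul_apply, smul_apply, hm, real_inner_self_eq_norm_sq, smul_eq_mul]
  · have e1 := abs_le.mp (hb u v w)
    have e2 := abs_le.mp (hb v u w)
    have e3 := abs_le.mp (hb w u v)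
    rw [show 6 * ‖u‖ * ‖v‖ / ‖z‖ ^ 3 * ‖w‖ = 2 * ‖u‖ * ‖v‖ * ‖w‖ / ‖z‖ ^ 3
      + 2 * ‖v‖ * ‖u‖ * ‖w‖ / ‖z‖ ^ 3 + 2 * ‖w‖ * ‖u‖ * ‖v‖ / ‖z‖ ^ 3 by ring]
    rw [abs_le]
    constructor <;> linarith

end Cylinder

/-! ### Bounds for g and J on compact sets, and for the metric on the fibers -/

section Bounds

variable {E : Type*} [NormedAddCommGroup E] [NormedSpace ℝ E]

/-- The metric `g` and the almost complex structure `J` are bounded by `C` at `P`, together with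
their first derivatives, and `g` is bounded below. -/
structure LocalBounds (g : E × ℂ × ℂ → (E × ℂ × ℂ) →L[ℝ] (E × ℂ × ℂ) →L[ℝ] ℝ)
    (J : E × ℂ × ℂ → (E × ℂ × ℂ) →L[ℝ] (E × ℂ × ℂ)) (C : ℝ) (P : E × ℂ × ℂ) : Prop where
  symm : ∀ u v, g P u v = g P v u
  diff_g : DifferentiableAt ℝ g P
  diff_J : DifferentiableAt ℝ J P
  lower : ∀ u, ‖u‖ ^ 2 ≤ C * g P u u
  upper : ∀ u v, |g P u v| ≤ C * ‖u‖ * ‖v‖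
  fderiv_g : ∀ u v w, |fderiv ℝ g P u v w| ≤ C * ‖u‖ * ‖v‖ * ‖w‖
  norm_J : ∀ u, ‖J P u‖ ≤ C * ‖u‖
  fderiv_J : ∀ u v, ‖fderiv ℝ J P u v‖ ≤ C * ‖u‖ * ‖v‖

/-- Continuity on K gives the upper bounds. The lower bound for g comes from bounding 1/g(u,u) on K
times the unit sphere, and homogeneity. The number B is a prescribed lower bound for the constant,
so that one constant can serve all later estimates. -/
theorem exists_localBounds [FiniteDimensional ℝ E] {U : Set (E × ℂ × ℂ)}
    {g : E × ℂ × ℂ → (E × ℂ × ℂ) →L[ℝ] (E × ℂ × ℂ) →L[ℝ] ℝ}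
    {J : E × ℂ × ℂ → (E × ℂ × ℂ) →L[ℝ] (E × ℂ × ℂ)} (hZ : IsLocalModel U g J)
    {K : Set (E × ℂ × ℂ)} (hK : IsCompact K) (hKU : K ⊆ U) (B : ℝ) :
    ∃ C, 1 ≤ C ∧ B ≤ C ∧ ∀ P ∈ K, LocalBounds g J C P := by
  have := FiniteDimensional.proper ℝ (E × ℂ × ℂ)
  obtain ⟨C₁, h₁⟩ := hK.exists_bound_of_continuousOn
    (E := (E × ℂ × ℂ) →L[ℝ] (E × ℂ × ℂ) →L[ℝ] ℝ) (hZ.smooth_g.continuousOn.mono hKU)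
  obtain ⟨C₂, h₂⟩ := hK.exists_bound_of_continuousOn
    (E := (E × ℂ × ℂ) →L[ℝ] (E × ℂ × ℂ) →L[ℝ] (E × ℂ × ℂ) →L[ℝ] ℝ)
    ((hZ.smooth_g.continuousOn_fderiv_of_isOpen hZ.isOpen (by simp)).mono hKU)
  obtain ⟨C₃, h₃⟩ := hK.exists_bound_of_continuousOn
    (E := (E × ℂ × ℂ) →L[ℝ] (E × ℂ × ℂ)) (hZ.smooth_J.continuousOn.mono hKU)
  obtain ⟨C₄, h₄⟩ := hK.exists_bound_of_continuousOn
    (E := (E × ℂ × ℂ) →L[ℝ] (E × ℂ × ℂ) →L[ℝ] (E × ℂ × ℂ))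
    ((hZ.smooth_J.continuousOn_fderiv_of_isOpen hZ.isOpen (by simp)).mono hKU)
  have hS : IsCompact (K ×ˢ Metric.sphere (0 : E × ℂ × ℂ) 1) := hK.prod (isCompact_sphere 0 1)
  have hcont : ContinuousOn (fun r : (E × ℂ × ℂ) × (E × ℂ × ℂ) => g r.1 r.2 r.2)
      (K ×ˢ Metric.sphere (0 : E × ℂ × ℂ) 1) := by
    have hg : ContinuousOn (fun r : (E × ℂ × ℂ) × (E × ℂ × ℂ) => g r.1)
        (K ×ˢ Metric.sphere (0 : E × ℂ × ℂ) 1) :=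
      (hZ.smooth_g.continuousOn.mono hKU).comp continuousOn_fst (fun r hr => hr.1)
    exact (hg.clm_apply continuousOn_snd).clm_apply continuousOn_snd
  have hpos : ∀ r ∈ K ×ˢ Metric.sphere (0 : E × ℂ × ℂ) 1, 0 < g r.1 r.2 r.2 := fun r hr =>
    hZ.pos _ (hKU hr.1) _ (by
      rintro h
      have := hr.2
      rw [h] at this
      simp at this)
  obtain ⟨C₅, h₅⟩ := hS.exists_bound_of_continuousOn (hcont.inv₀ fun r hr => (hpos r hr).ne')
  set C := |C₁| + |C₂| + |C₃| + |C₄| + |C₅| + |B| + 1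
  have p1 := abs_nonneg C₁
  have p2 := abs_nonneg C₂
  have p3 := abs_nonneg C₃
  have p4 := abs_nonneg C₄
  have p5 := abs_nonneg C₅
  have p6 := abs_nonneg B
  have l1 : C₁ ≤ C := (le_abs_self _).trans (by simp only [C]; linarith)
  have l2 : C₂ ≤ C := (le_abs_self _).trans (by simp only [C]; linarith)
  have l3 : C₃ ≤ C := (le_abs_self _).trans (by simp only [C]; linarith)
  have l4 : C₄ ≤ C := (le_abs_self _).trans (by simp only [C]; linarith)
  have l5 : C₅ ≤ C := (le_abs_self _).trans (by simp only [C]; linarith)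
  refine ⟨C, by simp only [C]; linarith, (le_abs_self _).trans (by simp only [C]; linarith),
    fun P hP => ?_⟩
  have hnhds := hZ.isOpen.mem_nhds (hKU hP)
  constructor
  · exact hZ.symm P (hKU hP)
  · exact (hZ.smooth_g.contDiffAt hnhds).differentiableAt (by simp)
  · exact (hZ.smooth_J.contDiffAt hnhds).differentiableAt (by simp)
  · intro u
    rcases eq_or_ne u 0 with rfl | hu
    · simp
    have hn : ‖u‖ ≠ 0 := norm_ne_zero_iff.mpr hu
    have hn' : 0 < ‖u‖ := norm_pos_iff.mpr hu
    have hmem : (P, ‖u‖⁻¹ • u) ∈ K ×ˢ Metric.sphere (0 : E × ℂ × ℂ) 1 :=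
      ⟨hP, by simp [norm_smul, hn]⟩
    have h6 := (h₅ _ hmem).trans l5
    have h7 := hpos _ hmem
    simp only [map_smul, smul_apply, smul_eq_mul] at h7
    simp only [Pi.inv_apply, map_smul, smul_apply, smul_eq_mul, norm_inv, Real.norm_of_nonneg h7.le]
      at h6
    have h8 : 1 ≤ C * (‖u‖⁻¹ * (‖u‖⁻¹ * g P u u)) := by
      calc 1 = (‖u‖⁻¹ * (‖u‖⁻¹ * g P u u))⁻¹ * (‖u‖⁻¹ * (‖u‖⁻¹ * g P u u)) :=
            (inv_mul_cancel₀ h7.ne').symm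
        _ ≤ _ := by gcongr
    calc ‖u‖ ^ 2 ≤ ‖u‖ ^ 2 * (C * (‖u‖⁻¹ * (‖u‖⁻¹ * g P u u))) :=
          le_mul_of_one_le_right (by positivity) h8
      _ = C * g P u u := by field_simp
  · intro u v
    exact ((g P).le_opNorm₂ u v).trans (by gcongr; exact (h₁ P hP).trans l1)
  · intro u v w
    calc |fderiv ℝ g P u v w| ≤ ‖fderiv ℝ g P u‖ * ‖v‖ * ‖w‖ := (fderiv ℝ g P u).le_opNorm₂ v w
      _ ≤ (‖fderiv ℝ g P‖ * ‖u‖) * ‖v‖ * ‖w‖ := by gcongr; exact (fderiv ℝ g P).le_opNorm u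
      _ ≤ C * ‖u‖ * ‖v‖ * ‖w‖ := by gcongr; exact (h₂ P hP).trans l2
  · intro u
    exact ((J P).le_opNorm u).trans (by gcongr; exact (h₃ P hP).trans l3)
  · intro u v
    calc ‖fderiv ℝ J P u v‖ ≤ ‖fderiv ℝ J P‖ * ‖u‖ * ‖v‖ := (fderiv ℝ J P).le_opNorm₂ u v
      _ ≤ C * ‖u‖ * ‖v‖ := by gcongr; exact (h₄ P hP).trans l4

variable {g : E × ℂ × ℂ → (E × ℂ × ℂ) →L[ℝ] (E × ℂ × ℂ) →L[ℝ] ℝ}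
  {J : E × ℂ × ℂ → (E × ℂ × ℂ) →L[ℝ] (E × ℂ × ℂ)} {C : ℝ}

theorem LocalBounds.vecNorm_le {P : E × ℂ × ℂ} (h : LocalBounds g J C P) (hC : 1 ≤ C)
    (u : E × ℂ × ℂ) : vecNorm g P u ≤ C * ‖u‖ := by
  refine Real.sqrt_le_iff.mpr ⟨by positivity, ?_⟩
  calc g P u u ≤ C * ‖u‖ * ‖u‖ := (le_abs_self _).trans (h.upper u u)
    _ = C * 1 * ‖u‖ ^ 2 := by ring
    _ ≤ C * C * ‖u‖ ^ 2 := by gcongr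
    _ = (C * ‖u‖) ^ 2 := by ring

theorem LocalBounds.norm_le {P : E × ℂ × ℂ} (h : LocalBounds g J C P) (hC : 1 ≤ C)
    (u : E × ℂ × ℂ) : ‖u‖ ≤ C * vecNorm g P u := by
  have h0 := h.lower u
  have hg : 0 ≤ g P u u := by
    by_contra hn
    push Not at hn
    have := mul_neg_of_pos_of_neg (by linarith : (0 : ℝ) < C) hn
    nlinarith [sq_nonneg ‖u‖]
  refine abs_le_of_sq_le_sq' ?_ (by unfold vecNorm; positivity) |>.2
  rw [mul_pow, vecNorm, Real.sq_sqrt hg]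
  nlinarith

theorem metricFiber_eventuallyEq (lam : ℂ) {q : E × ℂ} (hq : q.2 ≠ 0) :
    metricFiber g lam =ᶠ[𝓝 q] fun q => (g (fiberIncl lam q)).bilinearComp
      (liftMap (-lam / q.2 ^ 2)) (liftMap (-lam / q.2 ^ 2)) := by
  filter_upwards [(isOpen_ne.preimage continuous_snd).mem_nhds hq] with y hy
  rw [metricFiber, pullbackMetric, fderiv_fiberIncl lam hy]

/-- For λ = 0 the chart of the fiber is the inclusion of X, so every estimate on X is a special
case. -/
theorem metricX_eq (g : E × ℂ × ℂ → (E × ℂ × ℂ) →L[ℝ] (E × ℂ × ℂ) →L[ℝ] ℝ) :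
    metricX g = metricFiber g 0 := by
  have : fiberIncl 0 = (xIncl : E × ℂ → E × ℂ × ℂ) := by
    ext q <;> simp [fiberIncl]
  rw [metricX, metricFiber, this]

/-- The Christoffel symbols of the metric on the fiber. Only the component of `u` in the direction
of `x` is measured on the logarithmic scale. -/
theorem norm_christoffel_metricFiber_le [FiniteDimensional ℝ E] {lam : ℂ} {q : E × ℂ} (hC : 1 ≤ C)
    (hq : q.2 ≠ 0) (h : LocalBounds g J C (fiberIncl lam q)) (hm : ‖-lam / q.2 ^ 2‖ ≤ C)
    (u v : E × ℂ) :
    ‖christoffel (metricFiber g lam) q u v‖ ≤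
      7 * C ^ 2 * (1 + C) ^ 3 * (‖u‖ + ‖u.2‖ / ‖q.2‖) * ‖v‖ := by
  set L := (liftMap (-lam / q.2 ^ 2) : (E × ℂ) →L[ℝ] E × ℂ × ℂ)
  have hC0 : 0 < C := by linarith
  have hev := metricFiber_eventuallyEq (g := g) lam hq
  have hL : ∀ u, ‖L u‖ ≤ (1 + C) * ‖u‖ := fun u =>
    (norm_liftMap_apply_le _ u).trans (by gcongr)
  have hf : ∀ u v w, fderiv ℝ (metricFiber g lam) q u v w =
      fderiv ℝ g (fiberIncl lam q) (L u) (L v) (L w)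
        + g (fiberIncl lam q) (liftDeriv lam q u v) (L w)
        + g (fiberIncl lam q) (L v) (liftDeriv lam q u w) := by
    intro u v w
    rw [hev.fderiv_eq]
    exact hasFDerivAt_bilinearComp h.diff_g (hasFDerivAt_fiberIncl lam hq)
      (hasFDerivAt_liftMap lam hq) u v w
  have hcoer : ∀ w, C⁻¹ * ‖w‖ ^ 2 ≤ metricFiber g lam q w w := by
    intro w
    rw [hev.eq_of_nhds]
    have h1 := h.lower (L w)
    have h2 : ‖w‖ ^ 2 ≤ ‖L w‖ ^ 2 := by gcongr; exact norm_le_norm_liftMap_apply _ w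
    rw [inv_mul_le_iff₀ hC0]
    exact h2.trans h1
  set r := ‖u.2‖ / ‖q.2‖
  have hr : 0 ≤ r := by positivity
  have hdd : ‖liftDeriv lam q u v‖ ≤ 2 * C * r * ‖v‖ :=
    (norm_liftDeriv_apply_le lam hq u v).trans (by gcongr)
  have hDg : ∀ u v w, |fderiv ℝ g (fiberIncl lam q) (L u) (L v) (L w)| ≤
      C * (1 + C) ^ 3 * ‖u‖ * ‖v‖ * ‖w‖ := by
    intro u v w
    calc _ ≤ C * ‖L u‖ * ‖L v‖ * ‖L w‖ := h.fderiv_g _ _ _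
      _ ≤ C * ((1 + C) * ‖u‖) * ((1 + C) * ‖v‖) * ((1 + C) * ‖w‖) := by
          gcongr <;> exact hL _
      _ = _ := by ring
  have hmain := norm_christoffel_le (G := metricFiber g lam) (q := q) (inv_pos.mpr hC0) hcoer
    (u := u) (v := v) (D := 7 * C * (1 + C) ^ 3 * (‖u‖ + r) * ‖v‖) (by positivity) (fun w => ?_)
  · refine hmain.trans_eq ?_
    rw [div_inv_eq_mul]; ring
  · rw [hf u v w, hf v u w, hf w u v]
    have e1 := abs_le.mp (hDg u v w)
    have e2 := abs_le.mp (hDg v u w)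
    have e3 := abs_le.mp (hDg w u v)
    have e4 : |g (fiberIncl lam q) (liftDeriv lam q u v) (L w)| ≤
        2 * C ^ 2 * (1 + C) * r * ‖v‖ * ‖w‖ := by
      calc _ ≤ C * ‖liftDeriv lam q u v‖ * ‖L w‖ := h.upper _ _
        _ ≤ C * (2 * C * r * ‖v‖) * ((1 + C) * ‖w‖) := by gcongr; exact hL w
        _ = _ := by ring
    have e5 := abs_le.mp e4
    -- By symmetry of the second derivative D of the inclusion, in the Koszul sum the terms with
    -- D(u,w) and D(v,w) cancel, and 2g(D(u,v), Lw) is left. So the pole enters only through u^x/x,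
    -- with no derivative in the directions v, w.
    rw [liftDeriv_comm lam q v u, liftDeriv_comm lam q w u, liftDeriv_comm lam q w v,
      h.symm (L v) (liftDeriv lam q u w)]
    have e6 : 2 * (2 * C ^ 2 * (1 + C) * r * ‖v‖ * ‖w‖) ≤
        7 * C * (1 + C) ^ 3 * r * ‖v‖ * ‖w‖ := by
      have : 2 * (2 * C ^ 2 * (1 + C)) ≤ 7 * C * (1 + C) ^ 3 := by nlinarith [pow_pos hC0 2, pow_pos hC0 3, pow_pos hC0 4]
      calc _ = 2 * (2 * C ^ 2 * (1 + C)) * (r * ‖v‖ * ‖w‖) := by ring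
        _ ≤ 7 * C * (1 + C) ^ 3 * (r * ‖v‖ * ‖w‖) := by gcongr
        _ = _ := by ring
    have e7 : 0 ≤ C * (1 + C) ^ 3 * ‖u‖ * ‖v‖ * ‖w‖ := by positivity
    rw [show 7 * C * (1 + C) ^ 3 * (‖u‖ + r) * ‖v‖ * ‖w‖ =
      7 * (C * (1 + C) ^ 3 * ‖u‖ * ‖v‖ * ‖w‖) + 7 * C * (1 + C) ^ 3 * r * ‖v‖ * ‖w‖ by ring]
    have c1 : C * (1 + C) ^ 3 * ‖v‖ * ‖u‖ * ‖w‖ = C * (1 + C) ^ 3 * ‖u‖ * ‖v‖ * ‖w‖ := by ring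
    have c2 : C * (1 + C) ^ 3 * ‖w‖ * ‖u‖ * ‖v‖ = C * (1 + C) ^ 3 * ‖u‖ * ‖v‖ * ‖w‖ := by ring
    rw [c1] at e2
    rw [c2] at e3
    rw [abs_le]
    constructor <;> linarith

end Bounds


/-! ### Pointwise bounds along a map, and covariant against ordinary derivatives -/

section Pointwise

variable {E : Type*} [NormedAddCommGroup E] [NormedSpace ℝ E]
  {g : E × ℂ × ℂ → (E × ℂ × ℂ) →L[ℝ] (E × ℂ × ℂ) →L[ℝ] ℝ}
  {J : E × ℂ × ℂ → (E × ℂ × ℂ) →L[ℝ] (E × ℂ × ℂ)} {C : ℝ}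

/-- The endomorphism induced by `J` on the tangent spaces of the fiber, in the coordinates
`(v, x)`. -/
def fiberJ (J : E × ℂ × ℂ → (E × ℂ × ℂ) →L[ℝ] (E × ℂ × ℂ)) (lam : ℂ) (q : E × ℂ) :
    (E × ℂ) →L[ℝ] (E × ℂ) :=
  proj.comp ((J (fiberIncl lam q)).comp (fderiv ℝ (fiberIncl lam) q))

theorem complexX_eq (J : E × ℂ × ℂ → (E × ℂ × ℂ) →L[ℝ] (E × ℂ × ℂ)) :
    complexX J = fiberJ J 0 := by
  have : fiberIncl 0 = (xIncl : E × ℂ → E × ℂ × ℂ) := by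
    ext q <;> simp [fiberIncl]
  ext1 q
  rw [complexX, fiberJ, this, ContinuousLinearMap.fderiv]

/-- Bounds at `z` for the geometry of the fiber `x y = lam` along the map `φ`, given in the
coordinates `(v, x)`. -/
structure LiftBounds (g : E × ℂ × ℂ → (E × ℂ × ℂ) →L[ℝ] (E × ℂ × ℂ) →L[ℝ] ℝ)
    (J : E × ℂ × ℂ → (E × ℂ × ℂ) →L[ℝ] (E × ℂ × ℂ)) (lam : ℂ) (C : ℝ) (φ : ℂ → E × ℂ)
    (z : ℂ) : Prop where
  diff : DifferentiableAt ℝ φ z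
  ne_zero : (φ z).2 ≠ 0
  norm_le : ∀ w, ‖w‖ ≤ C * vecNorm g (fiberIncl lam (φ z)) (fderiv ℝ (fiberIncl lam) (φ z) w)
  vecNorm_le : ∀ w, vecNorm g (fiberIncl lam (φ z)) w ≤ C * ‖w‖
  lift_le : ∀ w, ‖fderiv ℝ (fiberIncl lam) (φ z) w‖ ≤ C * ‖w‖
  J_le : ∀ w, ‖J (fiberIncl lam (φ z)) w‖ ≤ C * ‖w‖
  christoffel_le : ∀ u v, ‖z‖ * ‖christoffel (metricFiber g lam) (φ z) (fderiv ℝ φ z u) v‖ ≤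
    C * ‖u‖ * ‖v‖
  fiberJ_le : ∀ w, ‖fiberJ J lam (φ z) w‖ ≤ C * ‖w‖
  fiberJ_diff : DifferentiableAt ℝ (fun z' => fiberJ J lam (φ z')) z
  fiberJ_deriv : ∀ u v, ‖z‖ * ‖fderiv ℝ (fun z' => fiberJ J lam (φ z')) z u v‖ ≤ C * ‖u‖ * ‖v‖

theorem norm_proj_le (u : E × ℂ × ℂ) : ‖proj u‖ ≤ ‖u‖ := by
  rw [proj_apply]
  exact norm_prod_le_iff.mpr ⟨norm_fst_le u, (norm_fst_le u.2).trans (norm_snd_le u)⟩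

theorem hasFDerivAt_fiberJ {lam : ℂ} {q : E × ℂ} (hq : q.2 ≠ 0)
    (hJ : DifferentiableAt ℝ J (fiberIncl lam q)) :
    DifferentiableAt ℝ (fiberJ J lam) q ∧ ∀ u v, fderiv ℝ (fiberJ J lam) q u v =
      proj (fderiv ℝ J (fiberIncl lam q) (liftMap (-lam / q.2 ^ 2) u) (liftMap (-lam / q.2 ^ 2) v)
        + J (fiberIncl lam q) (liftDeriv lam q u v)) := by
  have hJi : HasFDerivAt (fun q => J (fiberIncl lam q))
      ((fderiv ℝ J (fiberIncl lam q)).comp (liftMap (-lam / q.2 ^ 2))) q :=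
    HasFDerivAt.comp (g := J) (f := fiberIncl lam) q hJ.hasFDerivAt (hasFDerivAt_fiberIncl lam hq)
  have hev : fiberJ J lam =ᶠ[𝓝 q] fun q =>
      proj.comp ((J (fiberIncl lam q)).comp (liftMap (-lam / q.2 ^ 2))) := by
    filter_upwards [(isOpen_ne.preimage continuous_snd).mem_nhds hq] with y hy
    rw [fiberJ, fderiv_fiberIncl lam hy]
  have hd : HasFDerivAt (fiberJ J lam) _ q :=
    ((hasFDerivAt_const (proj (E := E)) q).clm_comp
      (hJi.clm_comp (hasFDerivAt_liftMap lam hq))).congr_of_eventuallyEq hev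
  refine ⟨hd.differentiableAt, fun u v => ?_⟩
  rw [hd.fderiv]
  simp [add_comm]

/-- The bound on |z||dφ| handles the regular terms, and |z||dφ^x| ≤ C|φ^x| absorbs the pole u^x/x in
the Christoffel symbols and in the derivative of the endomorphism induced by J. The first of these
gives the factor 14 = 7 · 2. -/
theorem LocalBounds.liftBounds [FiniteDimensional ℝ E] {lam : ℂ} {φ : ℂ → E × ℂ} {z : ℂ}
    (hC : 1 ≤ C) (h : LocalBounds g J C (fiberIncl lam (φ z))) (hφ : DifferentiableAt ℝ φ z)
    (hne : (φ z).2 ≠ 0) (hm : ‖-lam / (φ z).2 ^ 2‖ ≤ C)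
    (hd : ∀ u, ‖z‖ * ‖fderiv ℝ φ z u‖ ≤ C * ‖u‖)
    (hd₂ : ∀ u, ‖z‖ * ‖(fderiv ℝ φ z u).2‖ ≤ C * ‖(φ z).2‖ * ‖u‖) :
    LiftBounds g J lam (14 * C ^ 3 * (1 + C) ^ 3) φ z := by
  set L := (liftMap (-lam / (φ z).2 ^ 2) : (E × ℂ) →L[ℝ] E × ℂ × ℂ)
  set C' := 14 * C ^ 3 * (1 + C) ^ 3
  have hC0 : 0 < C := by linarith
  have hpos : 0 < ‖(φ z).2‖ := norm_pos_iff.mpr hne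
  have h1C : 1 ≤ 1 + C := by linarith
  have hCC : 1 + C ≤ C' := by
    have h1 : 1 ≤ C ^ 3 := one_le_pow₀ hC
    have h2 : 1 + C ≤ (1 + C) ^ 3 := le_self_pow₀ h1C (by norm_num)
    calc 1 + C ≤ (1 + C) ^ 3 := h2
      _ = 1 * 1 * (1 + C) ^ 3 := by ring
      _ ≤ 14 * C ^ 3 * (1 + C) ^ 3 := by gcongr; norm_num
  have hCC' : C ≤ C' := by linarith
  have hL : ∀ u, ‖L u‖ ≤ (1 + C) * ‖u‖ := fun u =>
    (norm_liftMap_apply_le _ u).trans (by gcongr)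
  have hd₂' : ∀ u, ‖z‖ * (‖(fderiv ℝ φ z u).2‖ / ‖(φ z).2‖) ≤ C * ‖u‖ := fun u => by
    rw [← mul_div_assoc, div_le_iff₀ hpos]
    exact (hd₂ u).trans_eq (by ring)
  have hfd := fderiv_fiberIncl lam hne
  obtain ⟨hJd, hJf⟩ := hasFDerivAt_fiberJ hne h.diff_J
  have hcomp : HasFDerivAt (fun z' => fiberJ J lam (φ z'))
      ((fderiv ℝ (fiberJ J lam) (φ z)).comp (fderiv ℝ φ z)) z :=
    HasFDerivAt.comp (g := fiberJ J lam) (f := φ) z hJd.hasFDerivAt hφ.hasFDerivAt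
  constructor
  · exact hφ
  · exact hne
  · intro w
    rw [hfd]
    calc ‖w‖ ≤ ‖L w‖ := norm_le_norm_liftMap_apply _ w
      _ ≤ C * _ := h.norm_le hC _
      _ ≤ C' * _ := by gcongr; exact Real.sqrt_nonneg _
  · intro w
    exact (h.vecNorm_le hC w).trans (by gcongr)
  · intro w
    rw [hfd]
    exact (hL w).trans (by gcongr)
  · intro w
    exact (h.norm_J w).trans (by gcongr)
  · intro u v
    calc _ ≤ ‖z‖ * (7 * C ^ 2 * (1 + C) ^ 3 *
          (‖fderiv ℝ φ z u‖ + ‖(fderiv ℝ φ z u).2‖ / ‖(φ z).2‖) * ‖v‖) := by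
          gcongr; exact norm_christoffel_metricFiber_le hC hne h hm _ v
      _ = 7 * C ^ 2 * (1 + C) ^ 3 * (‖z‖ * ‖fderiv ℝ φ z u‖
          + ‖z‖ * (‖(fderiv ℝ φ z u).2‖ / ‖(φ z).2‖)) * ‖v‖ := by ring
      _ ≤ 7 * C ^ 2 * (1 + C) ^ 3 * (C * ‖u‖ + C * ‖u‖) * ‖v‖ :=
          mul_le_mul_of_nonneg_right (mul_le_mul_of_nonneg_left (add_le_add (hd u) (hd₂' u))
            (by positivity)) (norm_nonneg _)
      _ = C' * ‖u‖ * ‖v‖ := by simp only [C']; ring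
  · intro w
    have : fiberJ J lam (φ z) w = proj (J (fiberIncl lam (φ z)) (L w)) := by
      rw [fiberJ, hfd]; rfl
    rw [this]
    calc _ ≤ ‖J (fiberIncl lam (φ z)) (L w)‖ := norm_proj_le _
      _ ≤ C * ‖L w‖ := h.norm_J _
      _ ≤ C * ((1 + C) * ‖w‖) := by gcongr; exact hL w
      _ = 1 * C * (1 + C) * ‖w‖ := by ring
      _ ≤ 14 * C ^ 3 * (1 + C) ^ 3 * ‖w‖ := by
          gcongr
          · norm_num
          · exact le_self_pow₀ hC (by norm_num)
          · exact le_self_pow₀ h1C (by norm_num)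
  · exact hcomp.differentiableAt
  · intro u v
    rw [hcomp.fderiv]
    have e : ((fderiv ℝ (fiberJ J lam) (φ z)).comp (fderiv ℝ φ z)) u v =
      proj (fderiv ℝ J (fiberIncl lam (φ z)) (L (fderiv ℝ φ z u)) (L v)
        + J (fiberIncl lam (φ z)) (liftDeriv lam (φ z) (fderiv ℝ φ z u) v)) := hJf _ _
    rw [e]
    have b1 : ‖fderiv ℝ J (fiberIncl lam (φ z)) (L (fderiv ℝ φ z u)) (L v)‖ ≤
        C * ((1 + C) * ‖fderiv ℝ φ z u‖) * ((1 + C) * ‖v‖) :=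
      (h.fderiv_J _ _).trans (by gcongr <;> exact hL _)
    have b2 : ‖J (fiberIncl lam (φ z)) (liftDeriv lam (φ z) (fderiv ℝ φ z u) v)‖ ≤
        C * (2 * C * (‖(fderiv ℝ φ z u).2‖ / ‖(φ z).2‖) * ‖v‖) :=
      (h.norm_J _).trans (by
        gcongr; exact (norm_liftDeriv_apply_le lam hne _ _).trans (by gcongr))
    calc _ ≤ ‖z‖ * (C * ((1 + C) * ‖fderiv ℝ φ z u‖) * ((1 + C) * ‖v‖) +
          C * (2 * C * (‖(fderiv ℝ φ z u).2‖ / ‖(φ z).2‖) * ‖v‖)) := by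
          gcongr
          exact (norm_proj_le _).trans ((norm_add_le _ _).trans (add_le_add b1 b2))
      _ = (C * (1 + C) ^ 2 * (‖z‖ * ‖fderiv ℝ φ z u‖) +
          2 * C ^ 2 * (‖z‖ * (‖(fderiv ℝ φ z u).2‖ / ‖(φ z).2‖))) * ‖v‖ := by ring
      _ ≤ (C * (1 + C) ^ 2 * (C * ‖u‖) + 2 * C ^ 2 * (C * ‖u‖)) * ‖v‖ :=
          mul_le_mul_of_nonneg_right (add_le_add
            (mul_le_mul_of_nonneg_left (hd u) (by positivity))
            (mul_le_mul_of_nonneg_left (hd₂' u) (by positivity))) (norm_nonneg _)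
      _ = (1 * C ^ 2 * (1 + C) ^ 2 + 2 * C ^ 3 * 1) * ‖u‖ * ‖v‖ := by ring
      _ ≤ (1 * C ^ 3 * (1 + C) ^ 3 + 2 * C ^ 3 * (1 + C) ^ 3) * ‖u‖ * ‖v‖ := by
          gcongr
          · norm_num
          · norm_num
          · exact one_le_pow₀ h1C
      _ = 3 * C ^ 3 * (1 + C) ^ 3 * ‖u‖ * ‖v‖ := by ring
      _ ≤ C' * ‖u‖ * ‖v‖ := by simp only [C']; gcongr; norm_num

/-- Together with `le_coNorm` this replaces Hilbert-Schmidt norms by the values on 1 and i with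
weight ‖z‖, independently of μ. -/
theorem coNorm_le {A' : Type*} (mu : ℂ) {z : ℂ} (hz : z ≠ 0) {N : A' → ℝ} (hN : ∀ a, 0 ≤ N a)
    (A : ℂ → A') : coNorm (cylDensity mu z) N A ≤ ‖z‖ * (N (A 1) + N (A Complex.I)) := by
  rw [coNorm, cylDensity_eq mu hz, div_inv_eq_mul]
  have h1 := hN (A 1)
  have h2 := hN (A Complex.I)
  refine Real.sqrt_le_iff.mpr ⟨by positivity, ?_⟩
  rw [mul_pow, mul_comm]
  gcongr
  nlinarith

theorem le_coNorm {A' : Type*} (mu : ℂ) {z : ℂ} (hz : z ≠ 0) (N : A' → ℝ)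
    (A : ℂ → A') {e : ℂ} (he : e = 1 ∨ e = Complex.I) :
    ‖z‖ * N (A e) ≤ coNorm (cylDensity mu z) N A := by
  rw [coNorm, cylDensity_eq mu hz, div_inv_eq_mul]
  refine Real.le_sqrt_of_sq_le ?_
  rw [mul_pow, mul_comm]
  gcongr
  rcases he with rfl | rfl
  · exact le_add_of_nonneg_right (sq_nonneg _)
  · exact le_add_of_nonneg_left (sq_nonneg _)

theorem coNorm_nonneg {A' : Type*} (d : ℝ) (N : A' → ℝ) (A : ℂ → A') : 0 ≤ coNorm d N A :=
  Real.sqrt_nonneg _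

theorem vecNorm_nonneg {W : Type*} [NormedAddCommGroup W] [NormedSpace ℝ W]
    (G : W → W →L[ℝ] W →L[ℝ] ℝ) (q u : W) : 0 ≤ vecNorm G q u := Real.sqrt_nonneg _

theorem vecNorm_metricX (g : E × ℂ × ℂ → (E × ℂ × ℂ) →L[ℝ] (E × ℂ × ℂ) →L[ℝ] ℝ) (q u : E × ℂ) :
    vecNorm (metricX g) q u =
      vecNorm g (fiberIncl 0 q) (fderiv ℝ (fiberIncl 0) q u) := by
  rw [metricX_eq]; rfl

theorem norm_eq_one_of {e : ℂ} (he : e = 1 ∨ e = Complex.I) : ‖e‖ = 1 := by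
  rcases he with rfl | rfl <;> simp

theorem norm_map_le {W : Type*} [NormedAddCommGroup W] [NormedSpace ℝ W] (η : ℂ →L[ℝ] W) (u : ℂ) :
    ‖η u‖ ≤ ‖u‖ * (‖η 1‖ + ‖η Complex.I‖) := by
  have h : η u = u.re • η 1 + u.im • η Complex.I := by
    rw [← map_smul, ← map_smul, ← map_add]
    congr 1
    apply Complex.ext <;> simp
  rw [h, mul_add]
  refine (norm_add_le _ _).trans (add_le_add ?_ ?_) <;> rw [norm_smul] <;> gcongr
  · exact Complex.abs_re_le_norm u
  · exact Complex.abs_im_le_norm u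

namespace LiftBounds

variable {lam mu : ℂ} {f φ : ℂ → E × ℂ} {F : ℂ → E × ℂ × ℂ} {z : ℂ}

theorem metricX_le (hC : 1 ≤ C) (h : LiftBounds g J 0 C f z) (w : E × ℂ) :
    vecNorm (metricX g) (f z) w ≤ C ^ 2 * ‖w‖ := by
  rw [vecNorm_metricX]
  calc _ ≤ C * ‖fderiv ℝ (fiberIncl 0) (f z) w‖ := h.vecNorm_le _
    _ ≤ C * (C * ‖w‖) := by gcongr; exact h.lift_le w
    _ = _ := by ring

theorem le_metricX (h : LiftBounds g J 0 C f z) (w : E × ℂ) :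
    ‖w‖ ≤ C * vecNorm (metricX g) (f z) w := by
  rw [vecNorm_metricX]; exact h.norm_le w

/-- The derivative of a section of `f^* TX` is controlled by its covariant derivative. -/
theorem norm_fderiv_le (hC : 1 ≤ C) (hz : z ≠ 0) (h : LiftBounds g J 0 C f z) (ξ : ℂ → E × ℂ)
    {e : ℂ} (he : e = 1 ∨ e = Complex.I) :
    ‖z‖ * ‖fderiv ℝ ξ z e‖ ≤ C * gradNormX g f ξ z + C * ‖ξ z‖ := by
  have h1 : ‖z‖ * vecNorm (metricX g) (f z) (covAlong (metricX g) f ξ z e) ≤ gradNormX g f ξ z :=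
    le_coNorm 0 hz _ _ he
  have h2 := h.le_metricX (covAlong (metricX g) f ξ z e)
  have h3 := h.christoffel_le e (ξ z)
  rw [← metricX_eq, norm_eq_one_of he, mul_one] at h3
  have h4 : fderiv ℝ ξ z e = covAlong (metricX g) f ξ z e -
      christoffel (metricX g) (f z) (fderiv ℝ f z e) (ξ z) := by
    rw [covAlong, add_sub_cancel_right]
  calc _ ≤ ‖z‖ * (‖covAlong (metricX g) f ξ z e‖ +
        ‖christoffel (metricX g) (f z) (fderiv ℝ f z e) (ξ z)‖) := by
        rw [h4]; gcongr; exact norm_sub_le _ _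
    _ ≤ ‖z‖ * (C * vecNorm (metricX g) (f z) (covAlong (metricX g) f ξ z e)) + C * ‖ξ z‖ := by
        rw [mul_add]; gcongr
    _ = C * (‖z‖ * vecNorm (metricX g) (f z) (covAlong (metricX g) f ξ z e)) + C * ‖ξ z‖ := by
        ring
    _ ≤ _ := by gcongr

/-- The covariant derivative of a section of `F^* TZ_λ` is controlled by its derivative. -/
theorem norm_covFiber_le (hC : 1 ≤ C) (h : LiftBounds g J lam C φ z)
    (hF : ∀ᶠ z' in 𝓝 z, F z' = fiberIncl lam (φ z')) (ζ : ℂ → E × ℂ × ℂ)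
    {e : ℂ} (he : e = 1 ∨ e = Complex.I) :
    ‖z‖ * ‖covFiber g lam F ζ z e‖ ≤
      C * (‖z‖ * ‖fderiv ℝ (fun z' => proj (ζ z')) z e‖) + C ^ 2 * ‖proj (ζ z)‖ := by
  have hp : (fun z' => proj (F z')) =ᶠ[𝓝 z] φ := by
    filter_upwards [hF] with z' hz'
    rw [hz']; rfl
  have h3 := h.christoffel_le e (proj (ζ z))
  rw [norm_eq_one_of he, mul_one] at h3
  have hz' : proj (F z) = φ z := hp.eq_of_nhds
  rw [covFiber, covAlong, hp.fderiv_eq, hz']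
  calc _ ≤ ‖z‖ * (C * (‖fderiv ℝ (fun z' => proj (ζ z')) z e‖ +
        ‖christoffel (metricFiber g lam) (φ z) (fderiv ℝ φ z e) (proj (ζ z))‖)) := by
        gcongr
        refine (h.lift_le _).trans ?_
        gcongr
        exact norm_add_le _ _
    _ = C * (‖z‖ * ‖fderiv ℝ (fun z' => proj (ζ z')) z e‖) + C *
        (‖z‖ * ‖christoffel (metricFiber g lam) (φ z) (fderiv ℝ φ z e) (proj (ζ z))‖) := by ring
    _ ≤ C * (‖z‖ * ‖fderiv ℝ (fun z' => proj (ζ z')) z e‖) + C * (C * ‖proj (ζ z)‖) := by gcongr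
    _ = _ := by ring

theorem eventually_ne (h : LiftBounds g J lam C φ z) : ∀ᶠ z' in 𝓝 z, (φ z').2 ≠ 0 :=
  (continuous_snd.continuousAt.comp h.diff.continuousAt).eventually_ne h.ne_zero

theorem proj_lift {q : E × ℂ} (hq : q.2 ≠ 0) (lam : ℂ) (w : E × ℂ) :
    proj (fderiv ℝ (fiberIncl lam) q w) = w := by
  rw [fderiv_fiberIncl lam hq]; simp

/-- The projection inverts the lift on a whole neighborhood, so ξ̂ read in the chart has the same
derivative at z as ξ. -/
theorem eventually_lift (h : LiftBounds g J lam C φ z)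
    (hF : ∀ᶠ z' in 𝓝 z, F z' = fiberIncl lam (φ z')) :
    ∀ᶠ z' in 𝓝 z, ∀ w, proj (fderiv ℝ (fiberIncl lam) (proj (F z')) w) = w := by
  filter_upwards [hF, h.eventually_ne] with z' hz' hne w
  rw [hz']
  exact proj_lift hne lam w

end LiftBounds

end Pointwise


/-! ### Comparison estimates for sections, 1-forms and (0,1)-forms -/

section Comparison

variable {E : Type*} [NormedAddCommGroup E] [NormedSpace ℝ E]
  {g : E × ℂ × ℂ → (E × ℂ × ℂ) →L[ℝ] (E × ℂ × ℂ) →L[ℝ] ℝ}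
  {J : E × ℂ × ℂ → (E × ℂ × ℂ) →L[ℝ] (E × ℂ × ℂ)} {C : ℝ}

namespace LiftBounds

variable {lam mu : ℂ} {f φ : ℂ → E × ℂ} {F : ℂ → E × ℂ × ℂ} {z : ℂ}

theorem norm_form_le (hC : 1 ≤ C) (hz : z ≠ 0) (h : LiftBounds g J 0 C f z)
    (η : ℂ → ℂ →L[ℝ] (E × ℂ)) {e : ℂ} (he : e = 1 ∨ e = Complex.I) :
    ‖z‖ * ‖η z e‖ ≤ C * formNormX g f η z := by
  have h1 : ‖z‖ * vecNorm (metricX g) (f z) (η z e) ≤ formNormX g f η z := le_coNorm 0 hz _ _ he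
  calc _ ≤ ‖z‖ * (C * vecNorm (metricX g) (f z) (η z e)) := by gcongr; exact h.le_metricX _
    _ = C * (‖z‖ * vecNorm (metricX g) (f z) (η z e)) := by ring
    _ ≤ _ := by gcongr

/-- The derivative of an `f^* TX`-valued 1-form is controlled by its covariant derivative. -/
theorem norm_fderiv_form_le (hC : 1 ≤ C) (hz : z ≠ 0) (h : LiftBounds g J 0 C f z)
    (η : ℂ → ℂ →L[ℝ] (E × ℂ)) {e v : ℂ} (he : e = 1 ∨ e = Complex.I)
    (hv : v = 1 ∨ v = Complex.I) :
    ‖z‖ * (‖z‖ * ‖fderiv ℝ (fun z' => η z' v) z e‖) ≤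
      13 * C ^ 2 * (formGradNormX g f η z + formNormX g f η z) := by
  set FG := formGradNormX g f η z
  set FN := formNormX g f η z
  have hFN : 0 ≤ FN := coNorm_nonneg _ _ _
  have hFG : 0 ≤ FG := coNorm_nonneg _ _ _
  set Γ := christoffel (cylMetric 0) z e v
  set κ := covForm 0 (covAlong (metricX g) f) η z e v
  set X := christoffel (metricX g) (f z) (fderiv ℝ f z e) (η z v)
  -- One factor ‖z‖ belongs to the direction of differentiation, the other to the argument of the
  -- form.
  have h1 : ‖z‖ * (‖z‖ * vecNorm (metricX g) (f z) κ) ≤ FG := by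
    have a1 : ‖z‖ * coNorm (cylDensity 0 z) (vecNorm (metricX g) (f z))
        (covForm 0 (covAlong (metricX g) f) η z e) ≤ FG := le_coNorm 0 hz _ _ he
    have a2 : ‖z‖ * vecNorm (metricX g) (f z) κ ≤ coNorm (cylDensity 0 z)
        (vecNorm (metricX g) (f z)) (covForm 0 (covAlong (metricX g) f) η z e) :=
      le_coNorm 0 hz (vecNorm (metricX g) (f z)) (covForm 0 (covAlong (metricX g) f) η z e) hv
    exact (mul_le_mul_of_nonneg_left a2 (norm_nonneg _)).trans a1
  have h2 : fderiv ℝ (fun z' => η z' v) z e = κ + η z Γ - X := by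
    simp only [κ, covForm, covAlong, Γ, X]; abel
  have h3 : ‖z‖ * ‖Γ‖ ≤ 6 := by
    have := norm_christoffel_cylMetric_le 0 hz e v
    rwa [norm_eq_one_of he, norm_eq_one_of hv, mul_one, mul_one] at this
  have h4 : ‖z‖ * ‖X‖ ≤ C * ‖η z v‖ := by
    have := h.christoffel_le e (η z v)
    rwa [← metricX_eq, norm_eq_one_of he, mul_one] at this
  have b1 := h.norm_form_le hC hz η (e := 1) (Or.inl rfl)
  have bI := h.norm_form_le hC hz η (e := Complex.I) (Or.inr rfl)
  have bv := h.norm_form_le hC hz η hv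
  have t1 : ‖z‖ * (‖z‖ * ‖κ‖) ≤ C * FG := by
    calc _ ≤ ‖z‖ * (‖z‖ * (C * vecNorm (metricX g) (f z) κ)) := by
          gcongr; exact h.le_metricX _
      _ = C * (‖z‖ * (‖z‖ * vecNorm (metricX g) (f z) κ)) := by ring
      _ ≤ _ := by gcongr
  -- Γ has length at most 6/‖z‖ and is expanded in the basis 1, i, whence 12.
  have t2 : ‖z‖ * (‖z‖ * ‖η z Γ‖) ≤ 12 * C * FN := by
    calc _ ≤ ‖z‖ * (‖z‖ * (‖Γ‖ * (‖η z 1‖ + ‖η z Complex.I‖))) := by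
          gcongr; exact norm_map_le _ _
      _ = (‖z‖ * ‖Γ‖) * (‖z‖ * ‖η z 1‖ + ‖z‖ * ‖η z Complex.I‖) := by ring
      _ ≤ 6 * (C * FN + C * FN) := by gcongr
      _ = _ := by ring
  have t3 : ‖z‖ * (‖z‖ * ‖X‖) ≤ C ^ 2 * FN := by
    calc _ ≤ ‖z‖ * (C * ‖η z v‖) := by gcongr
      _ = C * (‖z‖ * ‖η z v‖) := by ring
      _ ≤ C * (C * FN) := by gcongr
      _ = _ := by ring
  have hCC : C ≤ C ^ 2 := le_self_pow₀ hC (by norm_num)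
  calc _ ≤ ‖z‖ * (‖z‖ * (‖κ‖ + ‖η z Γ‖ + ‖X‖)) := by
        rw [h2]; gcongr
        exact (norm_sub_le _ _).trans (add_le_add_left (norm_add_le _ _) _)
    _ = ‖z‖ * (‖z‖ * ‖κ‖) + ‖z‖ * (‖z‖ * ‖η z Γ‖) + ‖z‖ * (‖z‖ * ‖X‖) := by ring
    _ ≤ C * FG + 12 * C * FN + C ^ 2 * FN := add_le_add (add_le_add t1 t2) t3
    _ ≤ C ^ 2 * FG + 12 * C ^ 2 * FN + C ^ 2 * FN := by gcongr
    _ ≤ 13 * C ^ 2 * (FG + FN) := by nlinarith [mul_nonneg (sq_nonneg C) hFG]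

/-- The covariant derivative of an `F^* TZ_λ`-valued 1-form is controlled by its derivative. -/
theorem formGradNormZ_le (hC : 1 ≤ C) (hz : z ≠ 0) (h : LiftBounds g J lam C φ z)
    (hF : ∀ᶠ z' in 𝓝 z, F z' = fiberIncl lam (φ z')) (ζ : ℂ → ℂ →L[ℝ] (E × ℂ × ℂ)) {D : ℝ}
    (hD : ∀ e v : ℂ, (e = 1 ∨ e = Complex.I) → (v = 1 ∨ v = Complex.I) →
      ‖z‖ * (‖z‖ * ‖fderiv ℝ (fun z' => proj (ζ z' v)) z e‖) ≤ D)
    (hζ : ∀ v : ℂ, (v = 1 ∨ v = Complex.I) → ‖z‖ * ‖ζ z v‖ ≤ D) :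
    formGradNormZ g lam mu F ζ z ≤ 56 * C ^ 3 * D := by
  have hFz : F z = fiberIncl lam (φ z) := hF.self_of_nhds
  have hD0 : 0 ≤ D := le_trans (by positivity) (hζ 1 (Or.inl rfl))
  have hN : ∀ w, vecNorm g (F z) w ≤ C * ‖w‖ := fun w => by rw [hFz]; exact h.vecNorm_le w
  have key : ∀ e v : ℂ, (e = 1 ∨ e = Complex.I) → (v = 1 ∨ v = Complex.I) →
      ‖z‖ * (‖z‖ * vecNorm g (F z) (covForm mu (covFiber g lam F) ζ z e v)) ≤
        14 * C ^ 3 * D := by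
    intro e v he hv
    set Γ := christoffel (cylMetric mu) z e v
    have h3 : ‖z‖ * ‖Γ‖ ≤ 6 := by
      have := norm_christoffel_cylMetric_le mu hz e v
      rwa [norm_eq_one_of he, norm_eq_one_of hv, mul_one, mul_one] at this
    have t1 : ‖z‖ * (‖z‖ * ‖ζ z Γ‖) ≤ 12 * D := by
      calc _ ≤ ‖z‖ * (‖z‖ * (‖Γ‖ * (‖ζ z 1‖ + ‖ζ z Complex.I‖))) := by
            gcongr; exact norm_map_le _ _
        _ = (‖z‖ * ‖Γ‖) * (‖z‖ * ‖ζ z 1‖ + ‖z‖ * ‖ζ z Complex.I‖) := by ring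
        _ ≤ 6 * (D + D) := by
            gcongr
            · exact hζ 1 (Or.inl rfl)
            · exact hζ _ (Or.inr rfl)
        _ = _ := by ring
    have t2 : ‖z‖ * (‖z‖ * ‖covFiber g lam F (fun z' => ζ z' v) z e‖) ≤ C * D + C ^ 2 * D := by
      have := h.norm_covFiber_le hC hF (fun z' => ζ z' v) he
      calc _ ≤ ‖z‖ * (C * (‖z‖ * ‖fderiv ℝ (fun z' => proj (ζ z' v)) z e‖)
              + C ^ 2 * ‖proj (ζ z v)‖) := by gcongr
        _ = C * (‖z‖ * (‖z‖ * ‖fderiv ℝ (fun z' => proj (ζ z' v)) z e‖)) +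
              C ^ 2 * (‖z‖ * ‖proj (ζ z v)‖) := by ring
        _ ≤ C * D + C ^ 2 * D := by
            gcongr
            · exact hD e v he hv
            · exact le_trans (by gcongr; exact norm_proj_le _) (hζ v hv)
    calc _ ≤ ‖z‖ * (‖z‖ * (C * (‖covFiber g lam F (fun z' => ζ z' v) z e‖ + ‖ζ z Γ‖))) := by
          gcongr
          refine (hN _).trans ?_
          gcongr
          exact norm_sub_le _ _
      _ = C * (‖z‖ * (‖z‖ * ‖covFiber g lam F (fun z' => ζ z' v) z e‖) +
            ‖z‖ * (‖z‖ * ‖ζ z Γ‖)) := by ring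
      _ ≤ C * ((C * D + C ^ 2 * D) + 12 * D) := by gcongr
      _ = (C ^ 2 + C ^ 3 + 12 * C) * D := by ring
      _ ≤ (C ^ 3 + C ^ 3 + 12 * C ^ 3) * D := by
          gcongr
          · norm_num
          · exact le_self_pow₀ hC (by norm_num)
      _ = _ := by ring
  refine (coNorm_le mu hz (fun _ => coNorm_nonneg _ _ _) _).trans ?_
  have hin : ∀ e : ℂ, (e = 1 ∨ e = Complex.I) → ‖z‖ * coNorm (cylDensity mu z) (vecNorm g (F z))
      (covForm mu (covFiber g lam F) ζ z e) ≤ 28 * C ^ 3 * D := by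
    intro e he
    calc _ ≤ ‖z‖ * (‖z‖ * (vecNorm g (F z) (covForm mu (covFiber g lam F) ζ z e 1) +
          vecNorm g (F z) (covForm mu (covFiber g lam F) ζ z e Complex.I))) := by
          gcongr; exact coNorm_le mu hz (fun _ => vecNorm_nonneg _ _ _) _
      _ = ‖z‖ * (‖z‖ * vecNorm g (F z) (covForm mu (covFiber g lam F) ζ z e 1)) +
          ‖z‖ * (‖z‖ * vecNorm g (F z) (covForm mu (covFiber g lam F) ζ z e Complex.I)) := by ring
      _ ≤ 14 * C ^ 3 * D + 14 * C ^ 3 * D :=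
          add_le_add (key e 1 he (Or.inl rfl)) (key e _ he (Or.inr rfl))
      _ = _ := by ring
  rw [mul_add]
  calc _ ≤ 28 * C ^ 3 * D + 28 * C ^ 3 * D :=
        add_le_add (hin 1 (Or.inl rfl)) (hin _ (Or.inr rfl))
    _ = _ := by ring

theorem formNormZ_le (hC : 1 ≤ C) (hz : z ≠ 0) (h : LiftBounds g J lam C φ z)
    (hFz : F z = fiberIncl lam (φ z)) (ζ : ℂ → ℂ →L[ℝ] (E × ℂ × ℂ)) {D : ℝ}
    (hζ : ∀ v : ℂ, (v = 1 ∨ v = Complex.I) → ‖z‖ * ‖ζ z v‖ ≤ D) :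
    formNormZ g mu F ζ z ≤ 2 * C * D := by
  have hN : ∀ w, vecNorm g (F z) w ≤ C * ‖w‖ := fun w => by rw [hFz]; exact h.vecNorm_le w
  refine (coNorm_le mu hz (fun _ => vecNorm_nonneg _ _ _) _).trans ?_
  calc _ ≤ ‖z‖ * (C * ‖ζ z 1‖ + C * ‖ζ z Complex.I‖) := by gcongr <;> exact hN _
    _ = C * (‖z‖ * ‖ζ z 1‖ + ‖z‖ * ‖ζ z Complex.I‖) := by ring
    _ ≤ C * (D + D) := by
        gcongr
        · exact hζ 1 (Or.inl rfl)
        · exact hζ _ (Or.inr rfl)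
    _ = _ := by ring

theorem formNormX_le (hC : 1 ≤ C) (hz : z ≠ 0) (h : LiftBounds g J 0 C f z)
    (η : ℂ → ℂ →L[ℝ] (E × ℂ)) {D : ℝ}
    (hη : ∀ v : ℂ, (v = 1 ∨ v = Complex.I) → ‖z‖ * ‖η z v‖ ≤ D) :
    formNormX g f η z ≤ 2 * C ^ 2 * D := by
  refine (coNorm_le 0 hz (fun _ => vecNorm_nonneg _ _ _) _).trans ?_
  calc _ ≤ ‖z‖ * (C ^ 2 * ‖η z 1‖ + C ^ 2 * ‖η z Complex.I‖) := by
        gcongr <;> exact h.metricX_le hC _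
    _ = C ^ 2 * (‖z‖ * ‖η z 1‖ + ‖z‖ * ‖η z Complex.I‖) := by ring
    _ ≤ C ^ 2 * (D + D) := by
        gcongr
        · exact hη 1 (Or.inl rfl)
        · exact hη _ (Or.inr rfl)
    _ = _ := by ring

/-- The comparison of `ξ` and `ξ̂`. -/
theorem section_estimates (hC : 1 ≤ C) (hz : z ≠ 0) (h₀ : LiftBounds g J 0 C f z)
    (h : LiftBounds g J lam C φ z) (hF : ∀ᶠ z' in 𝓝 z, F z' = fiberIncl lam (φ z'))
    (ξ : ℂ → E × ℂ) :
    vecNorm (metricX g) (f z) (ξ z) ≤ C ^ 3 * vecNorm g (F z) (hat lam F ξ z) ∧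
    vecNorm g (F z) (hat lam F ξ z) ≤ C ^ 3 * vecNorm (metricX g) (f z) (ξ z) ∧
    gradNormZ g lam mu F (hat lam F ξ) z ≤
      4 * C ^ 4 * (gradNormX g f ξ z + vecNorm (metricX g) (f z) (ξ z)) ∧
    ((ξ z).2 = 0 → (hat lam F ξ z).2 = 0) := by
  have hFz : F z = fiberIncl lam (φ z) := hF.self_of_nhds
  have hpF : proj (F z) = φ z := by rw [hFz]; rfl
  have hhat : hat lam F ξ z = fderiv ℝ (fiberIncl lam) (φ z) (ξ z) := by rw [hat, hpF]
  have hV := h₀.le_metricX (ξ z)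
  set V := vecNorm (metricX g) (f z) (ξ z)
  set G := gradNormX g f ξ z
  have hV0 : 0 ≤ V := vecNorm_nonneg _ _ _
  have hG0 : 0 ≤ G := coNorm_nonneg _ _ _
  refine ⟨?_, ?_, ?_, fun h0 => ?_⟩
  · calc V ≤ C ^ 2 * ‖ξ z‖ := h₀.metricX_le hC _
      _ ≤ C ^ 2 * (C * vecNorm g (F z) (hat lam F ξ z)) := by
          rw [hhat, hFz]; gcongr; exact h.norm_le _
      _ = _ := by ring
  · rw [hhat, hFz]
    calc _ ≤ C * ‖fderiv ℝ (fiberIncl lam) (φ z) (ξ z)‖ := h.vecNorm_le _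
      _ ≤ C * (C * ‖ξ z‖) := by gcongr; exact h.lift_le _
      _ ≤ C * (C * (C * V)) := by gcongr
      _ = _ := by ring
  -- In the chart ξ̂ is ξ, so the bound of ∇ξ̂ by ∂ξ on the fiber can be chained with the bound of
  -- ∂ξ by ∇ξ on X.
  · have hev : (fun z' => proj (hat lam F ξ z')) =ᶠ[𝓝 z] ξ := by
      filter_upwards [h.eventually_lift hF] with z' hz' using hz' _
    have key : ∀ e : ℂ, (e = 1 ∨ e = Complex.I) →
        ‖z‖ * vecNorm g (F z) (covFiber g lam F (hat lam F ξ) z e) ≤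
          C ^ 3 * G + 2 * C ^ 4 * V := by
      intro e he
      have h1 := h.norm_covFiber_le hC hF (hat lam F ξ) he
      rw [hev.fderiv_eq, hev.eq_of_nhds] at h1
      have h2 := h₀.norm_fderiv_le hC hz ξ he
      calc _ ≤ ‖z‖ * (C * ‖covFiber g lam F (hat lam F ξ) z e‖) := by
            gcongr; rw [hFz]; exact h.vecNorm_le _
        _ = C * (‖z‖ * ‖covFiber g lam F (hat lam F ξ) z e‖) := by ring
        _ ≤ C * (C * (C * G + C * ‖ξ z‖) + C ^ 2 * ‖ξ z‖) := by
            gcongr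
            exact h1.trans (by gcongr)
        _ = C ^ 3 * G + 2 * C ^ 3 * ‖ξ z‖ := by ring
        _ ≤ C ^ 3 * G + 2 * C ^ 3 * (C * V) := by gcongr
        _ = _ := by ring
    refine (coNorm_le mu hz (fun _ => vecNorm_nonneg _ _ _) _).trans ?_
    rw [mul_add]
    calc _ ≤ (C ^ 3 * G + 2 * C ^ 4 * V) + (C ^ 3 * G + 2 * C ^ 4 * V) :=
          add_le_add (key 1 (Or.inl rfl)) (key _ (Or.inr rfl))
      _ = 2 * C ^ 3 * G + 4 * C ^ 4 * V := by ring
      _ ≤ 4 * C ^ 4 * G + 4 * C ^ 4 * V := by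
          gcongr <;> norm_num
      _ = _ := by ring
  · rw [hhat, fderiv_fiberIncl lam h.ne_zero, liftMap_apply, h0]
    simp

/-- The comparison of `η` and `η̂`. -/
theorem form_estimates (hC : 1 ≤ C) (hz : z ≠ 0) (h₀ : LiftBounds g J 0 C f z)
    (h : LiftBounds g J lam C φ z) (hF : ∀ᶠ z' in 𝓝 z, F z' = fiberIncl lam (φ z'))
    (η : ℂ → ℂ →L[ℝ] (E × ℂ)) :
    formNormX g f η z ≤ 2 * C ^ 3 * formNormZ g mu F (hatForm lam F η) z ∧
    formNormZ g mu F (hatForm lam F η) z ≤ 2 * C ^ 3 * formNormX g f η z ∧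
    formGradNormZ g lam mu F (hatForm lam F η) z ≤
      728 * C ^ 5 * (formGradNormX g f η z + formNormX g f η z) ∧
    ((∀ u, (η z u).2 = 0) → ∀ u, (hatForm lam F η z u).2 = 0) := by
  have hFz : F z = fiberIncl lam (φ z) := hF.self_of_nhds
  have hpF : proj (F z) = φ z := by rw [hFz]; rfl
  have hhat : ∀ u, hatForm lam F η z u = fderiv ℝ (fiberIncl lam) (φ z) (η z u) := fun u => by
    rw [hatForm, hpF]; rfl
  set FN := formNormX g f η z
  set FG := formGradNormX g f η z
  have hFN : 0 ≤ FN := coNorm_nonneg _ _ _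
  have hFG : 0 ≤ FG := coNorm_nonneg _ _ _
  have hζ : ∀ v : ℂ, (v = 1 ∨ v = Complex.I) → ‖z‖ * ‖hatForm lam F η z v‖ ≤ C ^ 2 * FN := by
    intro v hv
    rw [hhat]
    calc _ ≤ ‖z‖ * (C * ‖η z v‖) := by gcongr; exact h.lift_le _
      _ = C * (‖z‖ * ‖η z v‖) := by ring
      _ ≤ C * (C * FN) := mul_le_mul_of_nonneg_left (h₀.norm_form_le hC hz η hv) (by positivity)
      _ = _ := by ring
  refine ⟨?_, ?_, ?_, fun h0 u => ?_⟩
  · refine (h₀.formNormX_le hC hz η (D := C * formNormZ g mu F (hatForm lam F η) z) ?_).trans_eq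
      (by ring)
    intro v hv
    have h1 : ‖z‖ * vecNorm g (F z) (hatForm lam F η z v) ≤ formNormZ g mu F (hatForm lam F η) z :=
      le_coNorm mu hz _ _ hv
    calc _ ≤ ‖z‖ * (C * vecNorm g (F z) (hatForm lam F η z v)) := by
          rw [hhat, hFz]; gcongr; exact h.norm_le _
      _ = C * (‖z‖ * vecNorm g (F z) (hatForm lam F η z v)) := by ring
      _ ≤ _ := by gcongr
  · exact (h.formNormZ_le hC hz hFz _ hζ).trans_eq (by ring)
  · refine (h.formGradNormZ_le hC hz hF _ (D := 13 * C ^ 2 * (FG + FN)) ?_ ?_).trans_eq (by ring)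
    · intro e v he hv
      have hev : (fun z' => proj (hatForm lam F η z' v)) =ᶠ[𝓝 z] fun z' => η z' v := by
        filter_upwards [h.eventually_lift hF] with z' hz' using hz' _
      rw [hev.fderiv_eq]
      exact h₀.norm_fderiv_form_le hC hz η he hv
    · intro v hv
      refine (hζ v hv).trans ?_
      have := mul_nonneg (sq_nonneg C) hFG
      have := mul_nonneg (sq_nonneg C) hFN
      linarith
  · rw [hhat, fderiv_fiberIncl lam h.ne_zero, liftMap_apply, h0]
    simp

/-- The comparison of `η = σ dz̄` and `η̃ = σ̂ dz̄`. -/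
theorem zeroOne_estimates (hC : 1 ≤ C) (hz : z ≠ 0) (h₀ : LiftBounds g J 0 C f z)
    (h : LiftBounds g J lam C φ z) (hF : ∀ᶠ z' in 𝓝 z, F z' = fiberIncl lam (φ z'))
    (η : ℂ → ℂ →L[ℝ] (E × ℂ)) (hη : DifferentiableAt ℝ η z)
    (hJ : η z (Complex.I * 1) = -complexX J (f z) (η z 1)) :
    formNormX g f η z ≤ 2 * C ^ 4 * formNormZ g mu F (hatZeroOne J lam F η) z ∧
    formNormZ g mu F (hatZeroOne J lam F η) z ≤ 2 * C ^ 4 * formNormX g f η z ∧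
    formGradNormZ g lam mu F (hatZeroOne J lam F η) z ≤
      784 * C ^ 6 * (formGradNormX g f η z + formNormX g f η z) ∧
    ((η z 1).2 = 0 → (hatZeroOne J lam F η z 1).2 = 0) := by
  have hFz : F z = fiberIncl lam (φ z) := hF.self_of_nhds
  have hpF : proj (F z) = φ z := by rw [hFz]; rfl
  have hhat1 : hatZeroOne J lam F η z 1 = fderiv ℝ (fiberIncl lam) (φ z) (η z 1) := by
    rw [hatZeroOne, hat, hpF]; simp
  have hhatI : hatZeroOne J lam F η z Complex.I =
      -J (fiberIncl lam (φ z)) (fderiv ℝ (fiberIncl lam) (φ z) (η z 1)) := by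
    rw [hatZeroOne, hat, hpF, hFz]; simp
  set FN := formNormX g f η z
  set FG := formGradNormX g f η z
  have hFN : 0 ≤ FN := coNorm_nonneg _ _ _
  have hFG : 0 ≤ FG := coNorm_nonneg _ _ _
  have b1 := h₀.norm_form_le hC hz η (e := 1) (Or.inl rfl)
  have hζ1 : ‖z‖ * ‖hatZeroOne J lam F η z 1‖ ≤ C ^ 2 * FN := by
    rw [hhat1]
    calc _ ≤ ‖z‖ * (C * ‖η z 1‖) := by gcongr; exact h.lift_le _
      _ = C * (‖z‖ * ‖η z 1‖) := by ring
      _ ≤ C * (C * FN) := by gcongr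
      _ = _ := by ring
  have hC23 : C ^ 2 ≤ C ^ 3 := pow_le_pow_right₀ hC (by norm_num)
  have hζ : ∀ v : ℂ, (v = 1 ∨ v = Complex.I) →
      ‖z‖ * ‖hatZeroOne J lam F η z v‖ ≤ C ^ 3 * FN := by
    rintro v (rfl | rfl)
    · exact hζ1.trans (by gcongr)
    · rw [hhatI, norm_neg]
      calc _ ≤ ‖z‖ * (C * ‖fderiv ℝ (fiberIncl lam) (φ z) (η z 1)‖) := by
            gcongr; exact h.J_le _
        _ = C * (‖z‖ * ‖hatZeroOne J lam F η z 1‖) := by rw [hhat1]; ring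
        _ ≤ C * (C ^ 2 * FN) := by gcongr
        _ = _ := by ring
  refine ⟨?_, ?_, ?_, fun h0 => ?_⟩
  · set N := formNormZ g mu F (hatZeroOne J lam F η) z
    have hN0 : 0 ≤ N := coNorm_nonneg _ _ _
    have h1 : ‖z‖ * ‖η z 1‖ ≤ C * N := by
      have a1 : ‖z‖ * vecNorm g (F z) (hatZeroOne J lam F η z 1) ≤ N :=
        le_coNorm mu hz _ _ (Or.inl rfl)
      calc _ ≤ ‖z‖ * (C * vecNorm g (F z) (hatZeroOne J lam F η z 1)) := by
            rw [hhat1, hFz]; gcongr; exact h.norm_le _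
        _ = C * (‖z‖ * vecNorm g (F z) (hatZeroOne J lam F η z 1)) := by ring
        _ ≤ _ := by gcongr
    refine (h₀.formNormX_le hC hz η (D := C ^ 2 * N) ?_).trans_eq (by ring)
    rintro v (rfl | rfl)
    · exact h1.trans (by gcongr; exact le_self_pow₀ hC (by norm_num))
    -- The coefficient σ̂ only remembers η(1); η(i) is recovered from the type of η.
    · rw [← mul_one Complex.I, hJ, norm_neg, complexX_eq]
      calc _ ≤ ‖z‖ * (C * ‖η z 1‖) := by gcongr; exact h₀.fiberJ_le _
        _ = C * (‖z‖ * ‖η z 1‖) := by ring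
        _ ≤ C * (C * N) := by gcongr
        _ = _ := by ring
  · exact (h.formNormZ_le hC hz hFz _ hζ).trans_eq (by ring)
  · have hD1 : 13 * C ^ 2 * (FG + FN) ≤ 14 * C ^ 3 * (FG + FN) := by gcongr; norm_num
    refine (h.formGradNormZ_le hC hz hF _ (D := 14 * C ^ 3 * (FG + FN)) ?_ ?_).trans_eq (by ring)
    · intro e v he hv
      have hd1 := h₀.norm_fderiv_form_le hC hz η he (v := 1) (Or.inl rfl)
      rcases hv with rfl | rfl
      · have hev : (fun z' => proj (hatZeroOne J lam F η z' 1)) =ᶠ[𝓝 z] fun z' => η z' 1 := by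
          filter_upwards [h.eventually_lift hF] with z' hz'
          have : hatZeroOne J lam F η z' 1 =
              fderiv ℝ (fiberIncl lam) (proj (F z')) (η z' 1) := by
            rw [hatZeroOne, hat]; simp
          rw [this]
          exact hz' _
        rw [hev.fderiv_eq]
        exact hd1.trans hD1
      -- On i the form is -Jσ̂, which in the chart is minus the induced endomorphism of the fiber
      -- applied to σ. The product rule, valid since η is differentiable, adds a derivative of this
      -- endomorphism.
      · have hev : (fun z' => proj (hatZeroOne J lam F η z' Complex.I)) =ᶠ[𝓝 z]
            fun z' => -fiberJ J lam (φ z') (η z' 1) := by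
          filter_upwards [hF] with z' hz'
          have hp' : proj (F z') = φ z' := by rw [hz']; rfl
          have : hatZeroOne J lam F η z' Complex.I =
              -J (F z') (fderiv ℝ (fiberIncl lam) (φ z') (η z' 1)) := by
            rw [hatZeroOne, hat, hp']; simp
          rw [this, hz', map_neg]
          rfl
        have hη1 : DifferentiableAt ℝ (fun z' => η z' 1) z :=
          hη.clm_apply (differentiableAt_const _)
        rw [hev.fderiv_eq, fderiv_fun_neg, fderiv_clm_apply h.fiberJ_diff hη1]
        have hb := h.fiberJ_deriv e (η z 1)
        rw [norm_eq_one_of he, mul_one] at hb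
        simp only [neg_apply, add_apply, ContinuousLinearMap.comp_apply,
          ContinuousLinearMap.flip_apply, norm_neg]
        calc _ ≤ ‖z‖ * (‖z‖ * (C * ‖fderiv ℝ (fun z' => η z' 1) z e‖ +
              ‖fderiv ℝ (fun z' => fiberJ J lam (φ z')) z e (η z 1)‖)) := by
              gcongr
              exact (norm_add_le _ _).trans (by gcongr; exact h.fiberJ_le _)
          _ = C * (‖z‖ * (‖z‖ * ‖fderiv ℝ (fun z' => η z' 1) z e‖)) +
              ‖z‖ * (‖z‖ * ‖fderiv ℝ (fun z' => fiberJ J lam (φ z')) z e (η z 1)‖) := by ring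
          _ ≤ C * (13 * C ^ 2 * (FG + FN)) + ‖z‖ * (C * ‖η z 1‖) := by gcongr
          _ = 13 * C ^ 3 * (FG + FN) + C * (‖z‖ * ‖η z 1‖) := by ring
          _ ≤ 13 * C ^ 3 * (FG + FN) + C * (C * FN) := by gcongr
          _ = 13 * C ^ 3 * (FG + FN) + C ^ 2 * FN := by ring
          _ ≤ 13 * C ^ 3 * (FG + FN) + C ^ 3 * (FG + FN) := by
              gcongr; linarith
          _ = _ := by ring
    · intro v hv
      refine (hζ v hv).trans ?_
      have h3 : 0 ≤ C ^ 3 := by positivity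
      have := mul_nonneg h3 hFG
      have := mul_nonneg h3 hFN
      linarith
  · rw [hhat1, fderiv_fiberIncl lam h.ne_zero, liftMap_apply, h0]
    simp

end LiftBounds

end Comparison


/-! ### The approximate map as a graph over a glued map -/

section Gluing

variable {E : Type*} [NormedAddCommGroup E] [NormedSpace ℝ E]

/-- The interpolation between `f` and its leading part `(p, a z^s)`. -/
def gluedMap (s : ℕ) (f : ℂ → E × ℂ) (p : E) (a : ℂ) (β : ℂ → ℝ) (z : ℂ) : E × ℂ :=
  f z + β z • ((p, a * z ^ s) - f z)

theorem norm_le_rho (mu z : ℂ) : ‖z‖ ≤ rho mu z :=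
  Real.le_sqrt_of_sq_le (le_add_of_nonneg_right (sq_nonneg _))

/-- With w = μ/z, both follow from |w||z| = |μ| and |w| ≤ M|z|. The first makes w small, the second
bounds the slope. -/
theorem norm_div_sq_le {M : ℝ} (hM : 0 < M) {mu z : ℂ} (hz : z ∈ omegaPlus M mu) :
    ‖mu / z‖ ^ 2 ≤ M * ‖mu‖ ∧ ‖mu‖ ≤ M * ‖z‖ ^ 2 := by
  obtain ⟨h0, h1, -⟩ := hz
  have hpos : 0 < ‖z‖ := norm_pos_iff.mpr h0
  rw [inv_mul_le_iff₀ hM] at h1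
  have h2 : ‖mu / z‖ * ‖z‖ = ‖mu‖ := by rw [norm_div, div_mul_cancel₀ _ hpos.ne']
  constructor
  · calc ‖mu / z‖ ^ 2 = ‖mu / z‖ * ‖mu / z‖ := sq _
      _ ≤ ‖mu / z‖ * (M * ‖z‖) := by gcongr
      _ = M * (‖mu / z‖ * ‖z‖) := by ring
      _ = M * ‖mu‖ := by rw [h2]
  · calc ‖mu‖ = ‖mu / z‖ * ‖z‖ := h2.symm
      _ ≤ M * ‖z‖ * ‖z‖ := by gcongr
      _ = _ := by ring

/-- The leading terms satisfy az^s · bw^s = λ, and the two error factors are inverse to each other.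
Where F is written through f₂, the value β = 1 removes the errors, so both formulas give (p, az^s,
bw^s). -/
theorem approxMap_eq {s : ℕ} {f₁ f₂ : ℂ → E × ℂ} {p : E} {a b mu lam : ℂ} {β : ℂ → ℝ} {z : ℂ}
    (hz : z ≠ 0) (ha : a ≠ 0) (hlam : a * b * mu ^ s = lam)
    (hβ : ‖mu / z‖ ≤ ‖z‖ ∨ β z = 1) (hne : (gluedMap s f₁ p a β z).2 ≠ 0) :
    approxMap s f₁ f₂ p a b mu β z = fiberIncl lam (gluedMap s f₁ p a β z) := by
  have haz : a * z ^ s ≠ 0 := mul_ne_zero ha (pow_ne_zero s hz)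
  have hw : (a * z ^ s) * (b * (mu / z) ^ s) = lam := by
    rw [← hlam, div_pow]
    have := pow_ne_zero s hz
    field_simp
  by_cases h : ‖mu / z‖ ≤ ‖z‖
  · have hx : a * z ^ s * (1 + ((1 - β z : ℝ) : ℂ) * relError s f₁ a z) =
        (gluedMap s f₁ p a β z).2 := by
      simp only [gluedMap, relError, Prod.snd_add, Prod.smul_snd, Prod.snd_sub, Complex.real_smul]
      push_cast
      field_simp
      ring
    have hx' := hx ▸ hne
    have h1 : (1 + ((1 - β z : ℝ) : ℂ) * relError s f₁ a z) ≠ 0 := right_ne_zero_of_mul hx'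
    simp only [approxMap, h, if_true]
    refine Prod.ext ?_ (Prod.ext hx ?_)
    · simp only [fiberIncl, gluedMap, Prod.fst_add, Prod.smul_fst, Prod.fst_sub]
      module
    · simp only [fiberIncl]
      rw [← hx, ← hw]
      field_simp
  · have hb : β z = 1 := hβ.resolve_left h
    have hg : gluedMap s f₁ p a β z = (p, a * z ^ s) := by simp [gluedMap, hb]
    simp only [approxMap, h, if_false, hb, hg, fiberIncl]
    refine Prod.ext (by simp) (Prod.ext (by simp) ?_)
    simp only [sub_self, Complex.ofReal_zero, zero_mul, add_zero, mul_one]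
    rw [← hw, mul_div_cancel_left₀ _ haz]

/-- For |z| ≤ δ the error C|z|^{s+1} is at most half of the lower bound |z|^s/C of the leading term.
For larger |z| the cutoff vanishes and c₁ bounds f^x, with |z|^s ≤ 1. -/
theorem gluedMap_snd_lower {C c₁ δ : ℝ} {s : ℕ} {f : ℂ → E × ℂ} {p : E} {a : ℂ}
    (hC : 0 < C) (hf : ContactBounds C s f p a) (hδ : 2 * C ^ 2 * δ ≤ 1)
    (hc : ∀ z : ℂ, δ ≤ ‖z‖ → ‖z‖ ≤ 1 → c₁ ≤ ‖(f z).2‖) (hc₁ : 0 ≤ c₁) {β : ℂ → ℝ} {z : ℂ}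
    (hz : ‖z‖ ≤ 1) (h0 : 0 ≤ β z) (h1 : β z ≤ 1) (h : β z = 0 ∨ ‖z‖ ≤ δ) :
    min c₁ (1 / (2 * C)) * ‖z‖ ^ s ≤ ‖(gluedMap s f p a β z).2‖ := by
  by_cases hzδ : ‖z‖ ≤ δ
  · have e : (gluedMap s f p a β z).2 =
        a * z ^ s + ((1 - β z : ℝ) : ℂ) * ((f z).2 - a * z ^ s) := by
      simp only [gluedMap, Prod.snd_add, Prod.smul_snd, Prod.snd_sub, Complex.real_smul]
      push_cast
      ring
    have b1 : ‖((1 - β z : ℝ) : ℂ) * ((f z).2 - a * z ^ s)‖ ≤ 1 / (2 * C) * ‖z‖ ^ s := by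
      rw [norm_mul, Complex.norm_real, Real.norm_of_nonneg (by linarith)]
      calc (1 - β z) * ‖(f z).2 - a * z ^ s‖ ≤ 1 * (C * ‖z‖ ^ (s + 1)) := by
            gcongr
            · linarith
            · exact hf.snd_sub z hz
        _ = C * ‖z‖ * ‖z‖ ^ s := by ring
        _ ≤ C * δ * ‖z‖ ^ s := by gcongr
        _ ≤ 1 / (2 * C) * ‖z‖ ^ s := by
            gcongr
            rw [le_div_iff₀ (by positivity)]
            linarith [hδ, show C * δ * (2 * C) = 2 * C ^ 2 * δ by ring]
    have b2 : 1 / C * ‖z‖ ^ s ≤ ‖a * z ^ s‖ := by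
      rw [norm_mul, norm_pow]
      gcongr
      rw [div_le_iff₀ hC, mul_comm]
      exact hf.le_leading
    have b3 : ‖a * z ^ s‖ ≤ ‖(gluedMap s f p a β z).2‖ +
        ‖((1 - β z : ℝ) : ℂ) * ((f z).2 - a * z ^ s)‖ := by
      rw [e]; exact norm_le_add_norm_add _ _
    have b4 : 1 / C = 1 / (2 * C) + 1 / (2 * C) := by field_simp; norm_num
    rw [b4, add_mul] at b2
    calc _ ≤ 1 / (2 * C) * ‖z‖ ^ s := by gcongr; exact min_le_right _ _
      _ ≤ _ := by linarith
  · have hb := h.resolve_right hzδ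
    have e : gluedMap s f p a β z = f z := by simp [gluedMap, hb]
    rw [e]
    calc _ ≤ c₁ * 1 := by
          gcongr
          · exact min_le_left _ _
          · exact pow_le_one₀ (norm_nonneg _) hz
      _ ≤ _ := by rw [mul_one]; exact hc z (le_of_not_ge hzδ) hz

theorem norm_gluedMap_sub_le {C : ℝ} {s : ℕ} {f : ℂ → E × ℂ} {p : E} {a : ℂ}
    (hC : 0 < C) (hf : ContactBounds C s f p a) {β : ℂ → ℝ} {z : ℂ} {r : ℝ}
    (hz : ‖z‖ ≤ 1) (h0 : 0 ≤ β z) (h1 : β z ≤ 1) (hr : 0 ≤ r) (h : β z = 0 ∨ ‖z‖ ≤ r) :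
    ‖gluedMap s f p a β z - f z‖ ≤ C * r := by
  rw [gluedMap, add_sub_cancel_left, norm_smul, Real.norm_of_nonneg h0]
  rcases h with h | h
  · rw [h, zero_mul]; positivity
  · have b : ‖(p, a * z ^ s) - f z‖ ≤ C * ‖z‖ := by
      refine norm_prod_le_iff.mpr ⟨?_, ?_⟩
      · rw [Prod.fst_sub, norm_sub_rev]; exact hf.fst_sub z hz
      · rw [Prod.snd_sub, norm_sub_rev]
        refine (hf.snd_sub z hz).trans ?_
        gcongr
        exact pow_le_of_le_one (norm_nonneg _) hz (by omega)
    calc _ ≤ 1 * (C * ‖z‖) := by gcongr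
      _ ≤ C * r := by rw [one_mul]; gcongr

theorem IsCutoff.norm_fderiv_le {mu : ℂ} {β : ℂ → ℝ} (hβ : IsCutoff mu β) {z : ℂ} (hz : z ≠ 0)
    (u : ℂ) : ‖z‖ * ‖fderiv ℝ β z u‖ ≤ 4 * ‖u‖ := by
  have h := hβ.deriv_le z hz
  have h1 := (le_coNorm mu hz (fun r : ℝ => |r|) (fderiv ℝ β z) (Or.inl rfl)).trans h
  have h2 := (le_coNorm mu hz (fun r : ℝ => |r|) (fderiv ℝ β z) (Or.inr rfl)).trans h
  calc _ ≤ ‖z‖ * (‖u‖ * (‖fderiv ℝ β z 1‖ + ‖fderiv ℝ β z Complex.I‖)) := by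
        gcongr; exact norm_map_le _ _
    _ = ‖u‖ * (‖z‖ * |fderiv ℝ β z 1| + ‖z‖ * |fderiv ℝ β z Complex.I|) := by
        rw [Real.norm_eq_abs, Real.norm_eq_abs]; ring
    _ ≤ ‖u‖ * (2 + 2) := by gcongr
    _ = _ := by ring

/-- The derivative is (1-β)df + β d(p, az^s) + dβ((p, az^s) - f). In the last term |z||dβ| ≤ 4 and
the difference is small to the order of contact, so the cutoff does not spoil the bound |z|^s for
the x-component. The three terms contribute 1, s and 4. -/
theorem gluedMap_fderiv_le {C : ℝ} {s : ℕ} (hs : 1 ≤ s) {f : ℂ → E × ℂ} {p : E} {a : ℂ}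
    (hC : 0 < C) (hf : ContactBounds C s f p a) {mu : ℂ} {β : ℂ → ℝ} (hβ : IsCutoff mu β) {z : ℂ}
    (hz0 : z ≠ 0) (hz : ‖z‖ ≤ 1) (hd : DifferentiableAt ℝ f z) :
    DifferentiableAt ℝ (gluedMap s f p a β) z ∧ ∀ u,
      ‖z‖ * ‖(fderiv ℝ (gluedMap s f p a β) z u).1‖ ≤ (5 + s) * C * ‖u‖ ∧
      ‖z‖ * ‖(fderiv ℝ (gluedMap s f p a β) z u).2‖ ≤ (5 + s) * C * ‖z‖ ^ s * ‖u‖ := by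
  have hβd : DifferentiableAt ℝ β z :=
    (hβ.smooth.contDiffAt (isOpen_ne.mem_nhds hz0)).differentiableAt (by simp)
  have hm : HasFDerivAt (fun z : ℂ => (p, a * z ^ s))
      ((0 : ℂ →L[ℝ] E).prod
        (ContinuousLinearMap.mul ℝ ℂ (a * (s * z ^ (s - 1))))) z := by
    refine (hasFDerivAt_const p z).prodMk ?_
    have := (((hasDerivAt_pow s z).const_mul a).hasFDerivAt.restrictScalars ℝ)
    refine this.congr_fderiv ?_
    ext x
    simp [mul_comm]
  have hg : HasFDerivAt (gluedMap s f p a β) _ z :=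
    hd.hasFDerivAt.add (hβd.hasFDerivAt.smul (hm.sub hd.hasFDerivAt))
  refine ⟨hg.differentiableAt, fun u => ?_⟩
  have h0 := hβ.nonneg z hz0
  have h1 := hβ.le_one z hz0
  have hβu := hβ.norm_fderiv_le hz0 u
  have e : fderiv ℝ (gluedMap s f p a β) z u =
      (1 - β z) • fderiv ℝ f z u + β z • (0, a * (s * z ^ (s - 1)) * u)
        + fderiv ℝ β z u • ((p, a * z ^ s) - f z) := by
    rw [hg.fderiv]
    simp only [add_apply, smul_apply, sub_apply, ContinuousLinearMap.prod_apply, zero_apply,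
      ContinuousLinearMap.smulRight_apply, ContinuousLinearMap.mul_apply']
    module
  have hzs : ‖z‖ ^ s = ‖z‖ * ‖z‖ ^ (s - 1) := by rw [← pow_succ']; congr 1; omega
  have hzs1 : ‖z‖ ^ (s + 1) ≤ ‖z‖ ^ s := pow_le_pow_of_le_one (norm_nonneg _) hz (Nat.le_succ s)
  have hs0 : (0 : ℝ) ≤ s := Nat.cast_nonneg s
  have h1β : ‖(1 - β z)‖ ≤ 1 := by rw [Real.norm_of_nonneg (by linarith)]; linarith
  have hβn : ‖β z‖ ≤ 1 := by rwa [Real.norm_of_nonneg h0]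
  have hf1 : ‖p - (f z).1‖ ≤ C * ‖z‖ := by rw [norm_sub_rev]; exact hf.fst_sub z hz
  have hf2 : ‖a * z ^ s - (f z).2‖ ≤ C * ‖z‖ ^ (s + 1) := by
    rw [norm_sub_rev]; exact hf.snd_sub z hz
  rw [e]
  constructor
  · have hf3 : ‖(fderiv ℝ f z u).1‖ ≤ C * ‖u‖ := (norm_fst_le _).trans (hf.fderiv_le z hz u)
    simp only [Prod.fst_add, Prod.smul_fst, Prod.fst_sub, smul_zero, add_zero]
    calc _ ≤ ‖z‖ * (1 * (C * ‖u‖) + ‖fderiv ℝ β z u‖ * (C * ‖z‖)) := by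
          gcongr
          refine (norm_add_le _ _).trans ?_
          rw [norm_smul, norm_smul]
          gcongr
      _ = C * ‖z‖ * ‖u‖ + (‖z‖ * ‖fderiv ℝ β z u‖) * (C * ‖z‖) := by ring
      _ ≤ C * 1 * ‖u‖ + (4 * ‖u‖) * (C * 1) := by gcongr
      _ = 5 * C * ‖u‖ := by ring
      _ ≤ (5 + s) * C * ‖u‖ := by gcongr; linarith
  · have hf3 := hf.fderiv_snd_le z hz u
    have hm3 : ‖z‖ * ‖a * (s * z ^ (s - 1)) * u‖ ≤ s * C * ‖z‖ ^ s * ‖u‖ := by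
      rw [norm_mul, norm_mul, norm_mul, norm_pow, Complex.norm_natCast, hzs]
      calc _ = ‖a‖ * (s * (‖z‖ * ‖z‖ ^ (s - 1)) * ‖u‖) := by ring
        _ ≤ C * (s * (‖z‖ * ‖z‖ ^ (s - 1)) * ‖u‖) := by gcongr; exact hf.leading_le
        _ = _ := by ring
    simp only [Prod.snd_add, Prod.smul_snd, Prod.snd_sub]
    calc _ ≤ ‖z‖ * (1 * ‖(fderiv ℝ f z u).2‖ + 1 * ‖a * (s * z ^ (s - 1)) * u‖ +
          ‖fderiv ℝ β z u‖ * (C * ‖z‖ ^ (s + 1))) := by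
          gcongr
          refine (norm_add₃_le).trans ?_
          rw [norm_smul, norm_smul, norm_smul]
          gcongr
      _ = ‖z‖ * ‖(fderiv ℝ f z u).2‖ + ‖z‖ * ‖a * (s * z ^ (s - 1)) * u‖ +
          (‖z‖ * ‖fderiv ℝ β z u‖) * (C * ‖z‖ ^ (s + 1)) := by ring
      _ ≤ C * ‖z‖ ^ s * ‖u‖ + s * C * ‖z‖ ^ s * ‖u‖ + (4 * ‖u‖) * (C * ‖z‖ ^ s) := by gcongr
      _ = _ := by ring

/-- Derivatives of F need the identity on a neighborhood, also at |w| = |z| where the definition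
switches. The inequality |w| < |z| is open; otherwise ρ² ≤ 2|w|² ≤ 2M|μ| < |μ|^{1/2}, which forces β
= 1 nearby. -/
theorem approxMap_eventuallyEq {M : ℝ} (hM : 0 < M) {s : ℕ} {f₁ f₂ : ℂ → E × ℂ} {p : E}
    {a b mu lam : ℂ} {β : ℂ → ℝ} {z : ℂ} (hz : z ∈ omegaPlus M mu) (ha : a ≠ 0) (hmu : mu ≠ 0)
    (hlam : a * b * mu ^ s = lam) (hβ : IsCutoff mu β)
    (hM' : 2 * M * ‖mu‖ < (‖mu‖ ^ (1 / 4 : ℝ)) ^ 2)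
    (hd : DifferentiableAt ℝ (gluedMap s f₁ p a β) z) (hne : (gluedMap s f₁ p a β z).2 ≠ 0) :
    ∀ᶠ z' in 𝓝 z, approxMap s f₁ f₂ p a b mu β z' = fiberIncl lam (gluedMap s f₁ p a β z') := by
  have hz0 := hz.1
  have hev1 : ∀ᶠ z' in 𝓝 z, z' ≠ 0 := isOpen_ne.mem_nhds hz0
  have hev2 : ∀ᶠ z' in 𝓝 z, (gluedMap s f₁ p a β z').2 ≠ 0 :=
    (continuous_snd.continuousAt.comp hd.continuousAt).eventually_ne hne
  have hcw : ContinuousAt (fun z' => ‖mu / z'‖) z :=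
    (continuousAt_const.div continuousAt_id hz0).norm
  have hev3 : ∀ᶠ z' in 𝓝 z, ‖mu / z'‖ ≤ ‖z'‖ ∨ β z' = 1 := by
    rcases lt_or_ge ‖mu / z‖ ‖z‖ with h | h
    · filter_upwards [hcw.eventually_lt continuous_norm.continuousAt h] with z' hz'
        using Or.inl hz'.le
    · have hrho : rho mu z < ‖mu‖ ^ (1 / 4 : ℝ) := by
        refine (Real.sqrt_lt' (Real.rpow_pos_of_pos (norm_pos_iff.mpr hmu) _)).mpr ?_
        have h2 := (norm_div_sq_le hM hz).1
        have h3 : ‖z‖ ^ 2 ≤ ‖mu / z‖ ^ 2 := by gcongr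
        linarith
      have hcr : ContinuousAt (rho mu) z :=
        ((continuous_norm.continuousAt.pow 2).add (hcw.pow 2)).sqrt
      filter_upwards [hcr.eventually_lt continuousAt_const hrho, hev1] with z' hz' h0
        using Or.inr (hβ.eq_one z' h0 hz'.le)
  filter_upwards [hev1, hev2, hev3] with z' h1 h2 h3 using approxMap_eq h1 ha hlam h3 h2

end Gluing


/-! ### Choice of constants and uniform bounds along f and F -/

section Assembly

variable {E : Type*} [NormedAddCommGroup E] [NormedSpace ℝ E]

/-- The points `(f(z), 0)`, `|z| ≤ 1`, of a compact family of maps form a compact set. -/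
theorem isCompact_image_family {T : Type*} [TopologicalSpace T] [CompactSpace T] {R : ℝ}
    (hR : 1 < R) {f : T → ℂ → E × ℂ} (hf : IsSmoothFamily R f) :
    IsCompact ((fun q : T × ℂ => (xIncl (f q.1 q.2) : E × ℂ × ℂ)) ''
      ((univ : Set T) ×ˢ Metric.closedBall (0 : ℂ) 1)) := by
  refine (isCompact_univ.prod (isCompact_closedBall 0 1)).image_of_continuousOn ?_
  have h0 := (ContinuousMultilinearMap.apply ℝ (fun _ : Fin 0 => ℂ) (E × ℂ)
    (fun _ => 1)).continuous.comp_continuousOn (hf.cont 0)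
  exact xIncl.continuous.comp_continuousOn
    (h0.mono (prod_mono le_rfl (Metric.closedBall_subset_ball hR)))

set_option maxHeartbeats 1000000 in
/-- The geometry of the fibers is uniformly bounded along `f` and along the approximate maps. -/
theorem exists_liftBounds [FiniteDimensional ℝ E] {T : Type*} [TopologicalSpace T]
    [CompactSpace T] {U : Set (E × ℂ × ℂ)}
    {g : E × ℂ × ℂ → (E × ℂ × ℂ) →L[ℝ] (E × ℂ × ℂ) →L[ℝ] ℝ}
    {J : E × ℂ × ℂ → (E × ℂ × ℂ) →L[ℝ] (E × ℂ × ℂ)} (hZ : IsLocalModel U g J)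
    {s : ℕ} {R : ℝ} (K : NodalFamily T U s R) {M : ℝ} (hM : 0 < M) :
    ∃ A, 1 ≤ A ∧ ∃ lamM > 0, ∀ (t : T) (lam mu : ℂ) (β : ℂ → ℝ), lam ≠ 0 → ‖lam‖ ≤ lamM →
      K.a t * K.b t * mu ^ s = lam → IsCutoff mu β → ∀ z ∈ omegaPlus M mu,
        z ∈ plusRegion mu R ∧
        fiberIncl lam (gluedMap s (K.f₁ t) (K.p t) (K.a t) β z) ∈ U ∧
        LiftBounds g J 0 A (K.f₁ t) z ∧
        LiftBounds g J lam A (gluedMap s (K.f₁ t) (K.p t) (K.a t) β) z ∧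
        ∀ᶠ z' in 𝓝 z, approxMap s (K.f₁ t) (K.f₂ t) (K.p t) (K.a t) (K.b t) mu β z' =
          fiberIncl lam (gluedMap s (K.f₁ t) (K.p t) (K.a t) β z') := by
  have := FiniteDimensional.proper ℝ (E × ℂ × ℂ)
  obtain ⟨C, hC, hf⟩ := exists_contactBounds K.one_lt K.one_le K.smooth₁ K.contact₁
  obtain ⟨C', hC', hf'⟩ := exists_contactBounds K.one_lt K.one_le K.smooth₂ K.contact₂
  set δ := 1 / (2 * C ^ 2)
  have hδ : 0 < δ := by positivity
  have hδC : 2 * C ^ 2 * δ ≤ 1 := le_of_eq (by simp only [δ]; field_simp)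
  obtain ⟨c₁, hc₁, hlow⟩ := exists_le_norm_snd K.one_lt K.smooth₁ K.contact₁ hδ
  set c₀ := min c₁ (1 / (2 * C))
  have hc₀ : 0 < c₀ := lt_min hc₁ (by positivity)
  set K₀ := (fun q : T × ℂ => (xIncl (K.f₁ q.1 q.2) : E × ℂ × ℂ)) ''
      ((univ : Set T) ×ˢ Metric.closedBall (0 : ℂ) 1)
  have hK₀ : IsCompact K₀ := isCompact_image_family K.one_lt K.smooth₁
  have hK₀U : K₀ ⊆ U := by
    rintro _ ⟨q, hq, rfl⟩
    exact K.mem₁ q.1 q.2 (Metric.closedBall_subset_ball K.one_lt hq.2)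
  -- F will stay in a compact neighborhood of the image of f inside U, on which g and J are bounded.
  obtain ⟨ε, hε, hεU⟩ := hK₀.exists_cthickening_subset_open hZ.isOpen hK₀U
  set D := C * C' / c₀
  have hD : 0 < D := by positivity
  -- The summands bound, in this order, |z||dφ|, |df|, |z||df^x|/|f^x|, |z||dφ^x|/|φ^x| and the
  -- slope |λ|/|φ^x|².
  obtain ⟨A, hA, hBA, hloc⟩ := exists_localBounds hZ (hK₀.cthickening (r := ε)) hεU
    ((5 + s) * C + C + C / c₀ + (5 + s) * C / c₀ + C * C' * M ^ s / c₀ ^ 2)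
  have hs0 : (0 : ℝ) ≤ s := Nat.cast_nonneg s
  have q1 : 0 < (5 + s) * C := by positivity
  have q2 : 0 < C / c₀ := by positivity
  have q3 : 0 < (5 + s) * C / c₀ := by positivity
  have q4 : 0 < C * C' * M ^ s / c₀ ^ 2 := by positivity
  have A1 : (5 + s) * C ≤ A := by linarith
  have A2 : C ≤ A := by linarith
  have A3 : C / c₀ ≤ A := by linarith
  have A4 : (5 + s) * C / c₀ ≤ A := by linarith
  have A5 : C * C' * M ^ s / c₀ ^ 2 ≤ A := by linarith
  have A0 : 0 ≤ A := by linarith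
  -- A threshold for τ = |μ|^{1/4}: 2τ ≤ δ places the cutoff where the leading term dominates, τ(2C
  -- + D) ≤ ε keeps F in the neighborhood of the image of f, and 2Mτ < 1 yields 2M|μ| < τ².
  set t₀ := min (min 1 (δ / 2)) (min (ε / (2 * C + D)) (1 / (2 * M + 2)))
  have ht₀ : 0 < t₀ := by positivity
  have ht1 : t₀ ≤ 1 := (min_le_left _ _).trans (min_le_left _ _)
  have ht2 : 2 * t₀ ≤ δ := by
    have : t₀ ≤ δ / 2 := (min_le_left _ _).trans (min_le_right _ _)
    linarith
  have ht3 : t₀ * (2 * C + D) ≤ ε := by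
    have : t₀ ≤ ε / (2 * C + D) := (min_le_right _ _).trans (min_le_left _ _)
    rwa [le_div_iff₀ (by positivity)] at this
  have ht4 : 2 * M * t₀ < 1 := by
    have : t₀ ≤ 1 / (2 * M + 2) := (min_le_right _ _).trans (min_le_right _ _)
    rw [le_div_iff₀ (by positivity)] at this
    linarith
  -- Since |a| ≥ 1/C and |b| ≥ 1/C', this bound on |λ| = |ab||μ|^s forces |μ| ≤ t₀⁴.
  refine ⟨14 * A ^ 3 * (1 + A) ^ 3, ?_, (t₀ ^ 4) ^ s / (C * C'), by positivity, ?_⟩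
  · have h1 : 1 ≤ A ^ 3 := one_le_pow₀ hA
    have h2 : 1 ≤ (1 + A) ^ 3 := one_le_pow₀ (by linarith)
    have h3 : 1 ≤ A ^ 3 * (1 + A) ^ 3 := one_le_mul_of_one_le_of_one_le h1 h2
    linarith
  intro t lam mu β hlam hlamM hab hβ z hz
  obtain ⟨hz0, hzw, hz1⟩ := id hz
  have hzpos : 0 < ‖z‖ := norm_pos_iff.mpr hz0
  have hzs : 0 < ‖z‖ ^ s := by positivity
  have hs : s ≠ 0 := by have := K.one_le; omega
  have ha0 := (K.contact₁ t).ne_zero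
  have hmu : mu ≠ 0 := by
    rintro rfl
    rw [zero_pow hs, mul_zero] at hab
    exact hlam hab.symm
  have hmupos : 0 < ‖mu‖ := norm_pos_iff.mpr hmu
  -- `τ = |μ|^{1/4}` is at most `t₀`
  set τ := ‖mu‖ ^ (1 / 4 : ℝ) with hτ
  have hτpos : 0 < τ := Real.rpow_pos_of_pos hmupos _
  have hτ4 : τ ^ 4 = ‖mu‖ := by
    rw [hτ, ← Real.rpow_natCast, ← Real.rpow_mul hmupos.le]; norm_num
  have hτ3 : τ ^ 3 = ‖mu‖ ^ (3 / 4 : ℝ) := by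
    rw [hτ, ← Real.rpow_natCast, ← Real.rpow_mul hmupos.le]; norm_num
  have hlamle : ‖lam‖ ≤ C * C' * ‖mu‖ ^ s := by
    rw [← hab, norm_mul, norm_mul, norm_pow]
    gcongr
    · exact (hf t).leading_le
    · exact (hf' t).leading_le
  have hτt : τ ≤ t₀ := by
    have h1 : ‖mu‖ ^ s ≤ (t₀ ^ 4) ^ s := by
      have hCa := (hf t).le_leading
      have hCb := (hf' t).le_leading
      rw [le_div_iff₀ (by positivity), ← hab, norm_mul, norm_mul, norm_pow] at hlamM
      have h2 : 1 ≤ (C * ‖K.a t‖) * (C' * ‖K.b t‖) := one_le_mul_of_one_le_of_one_le hCa hCb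
      calc ‖mu‖ ^ s ≤ (C * ‖K.a t‖) * (C' * ‖K.b t‖) * ‖mu‖ ^ s :=
            le_mul_of_one_le_left (by positivity) h2
        _ = ‖K.a t‖ * ‖K.b t‖ * ‖mu‖ ^ s * (C * C') := by ring
        _ ≤ _ := hlamM
    have h2 : ‖mu‖ ≤ t₀ ^ 4 := (pow_le_pow_iff_left₀ (by positivity) (by positivity) hs).mp h1
    rw [← hτ4] at h2
    exact (pow_le_pow_iff_left₀ hτpos.le ht₀.le (by norm_num)).mp h2
  have hτ1 : τ ≤ 1 := hτt.trans ht1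
  have hMτ : 2 * M * τ < 1 := lt_of_le_of_lt (by gcongr) ht4
  have hMτ2 : 2 * M * ‖mu‖ < τ ^ 2 := by
    rw [← hτ4]
    calc 2 * M * τ ^ 4 = (2 * M * τ) * τ * τ ^ 2 := by ring
      _ < 1 * τ ^ 2 := by
          gcongr
          calc 2 * M * τ * τ ≤ 2 * M * τ * 1 := by gcongr
            _ < 1 := by rw [mul_one]; exact hMτ
      _ = τ ^ 2 := one_mul _
  obtain ⟨hw2, hmuz⟩ := norm_div_sq_le hM hz
  have hw : ‖mu / z‖ ≤ τ := by
    refine (pow_le_pow_iff_left₀ (norm_nonneg _) hτpos.le two_ne_zero).mp ?_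
    have : 0 < M * ‖mu‖ := by positivity
    linarith
  have hβ0 := hβ.nonneg z hz0
  have hβ1 := hβ.le_one z hz0
  have hβτ : β z = 0 ∨ ‖z‖ ≤ 2 * τ := by
    rcases le_or_gt (2 * τ) (rho mu z) with h | h
    · exact Or.inl (hβ.eq_zero z hz0 h)
    · exact Or.inr ((norm_le_rho mu z).trans h.le)
  have hβδ : β z = 0 ∨ ‖z‖ ≤ δ := hβτ.imp_right fun h => h.trans (by linarith)
  have hzR : ‖z‖ < R := hz1.trans_lt K.one_lt
  have hfd : DifferentiableAt ℝ (K.f₁ t) z :=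
    ((K.smooth₁.smooth t).contDiffAt
      (Metric.isOpen_ball.mem_nhds (by simpa using hzR))).differentiableAt (by simp)
  set φ := gluedMap s (K.f₁ t) (K.p t) (K.a t) β with hφ
  obtain ⟨hφd, hφf⟩ := gluedMap_fderiv_le K.one_le hC (hf t) hβ hz0 hz1 hfd
  have hφlow : c₀ * ‖z‖ ^ s ≤ ‖(φ z).2‖ :=
    gluedMap_snd_lower hC (hf t) hδC (hlow t) hc₁.le hz1 hβ0 hβ1 hβδ
  have hflow : c₀ * ‖z‖ ^ s ≤ ‖(K.f₁ t z).2‖ := by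
    -- The map f is the glued map with zero cutoff.
    have := gluedMap_snd_lower (β := fun _ => 0) hC (hf t) hδC (hlow t) hc₁.le hz1 le_rfl
      zero_le_one (Or.inl rfl)
    have e : gluedMap s (K.f₁ t) (K.p t) (K.a t) (fun _ => 0) z = K.f₁ t z := by simp [gluedMap]
    rwa [e] at this
  have hc₀z : 0 < c₀ * ‖z‖ ^ s := by positivity
  have hφne : (φ z).2 ≠ 0 := norm_pos_iff.mp (hc₀z.trans_le hφlow)
  have hfne : (K.f₁ t z).2 ≠ 0 := norm_pos_iff.mp (hc₀z.trans_le hflow)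
  have hφpos := norm_pos_iff.mpr hφne
  have hmem₀ : (xIncl (K.f₁ t z) : E × ℂ × ℂ) ∈ K₀ := ⟨(t, z), ⟨trivial, by simpa using hz1⟩, rfl⟩
  have hmem₁ : (xIncl (K.f₁ t z) : E × ℂ × ℂ) ∈ Metric.cthickening ε K₀ :=
    Metric.self_subset_cthickening K₀ hmem₀
  have hmem : fiberIncl lam (φ z) ∈ Metric.cthickening ε K₀ := by
    refine Metric.mem_cthickening_of_dist_le _ _ ε K₀ hmem₀ ?_
    have hsub : ‖φ z - K.f₁ t z‖ ≤ C * (2 * τ) :=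
      norm_gluedMap_sub_le hC (hf t) hz1 hβ0 hβ1 (by positivity) hβτ
    have hsub' : C * (2 * τ) ≤ ε := by
      calc C * (2 * τ) ≤ C * (2 * t₀) := by gcongr
        _ ≤ t₀ * (2 * C + D) := by nlinarith [mul_pos ht₀ hD]
        _ ≤ ε := ht3
    -- Since |λ| ≤ CC'|z|^s|w|^s and |φ^x| ≥ c₀|z|^s, the third coordinate is at most D|w|^s ≤ Dτ.
    have hthird : ‖lam / (φ z).2‖ ≤ ε := by
      rw [norm_div, div_le_iff₀ hφpos]
      have hws : ‖mu / z‖ ^ s ≤ τ := (pow_le_pow_left₀ (norm_nonneg _) hw s).trans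
        (pow_le_of_le_one hτpos.le hτ1 hs)
      have e1 : ‖mu‖ = ‖mu / z‖ * ‖z‖ := by rw [norm_div, div_mul_cancel₀ _ hzpos.ne']
      calc ‖lam‖ ≤ C * C' * ‖mu‖ ^ s := hlamle
        _ = D * ‖mu / z‖ ^ s * (c₀ * ‖z‖ ^ s) := by
            rw [e1, mul_pow]; simp only [D]; field_simp
        _ ≤ D * τ * ‖(φ z).2‖ := by gcongr
        _ ≤ ε * ‖(φ z).2‖ := by
            gcongr
            calc D * τ ≤ D * t₀ := by gcongr
              _ ≤ t₀ * (2 * C + D) := by nlinarith [mul_pos ht₀ hC]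
              _ ≤ ε := ht3
    rw [dist_eq_norm]
    refine norm_prod_le_iff.mpr ⟨?_, norm_prod_le_iff.mpr ⟨?_, ?_⟩⟩
    · exact ((norm_fst_le (φ z - K.f₁ t z)).trans hsub).trans hsub'
    · exact ((norm_snd_le (φ z - K.f₁ t z)).trans hsub).trans hsub'
    · simpa [fiberIncl] using hthird
  have hfib₀ : fiberIncl 0 (K.f₁ t z) = xIncl (K.f₁ t z) := by simp [fiberIncl]
  refine ⟨⟨?_, hzR⟩, hεU hmem, ?_, ?_, ?_⟩
  -- If |z| < |μ|^{3/4}, then |μ| ≤ M|z|² < M|μ|^{3/2}, against 2M|μ| < |μ|^{1/2}.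
  · rw [← hτ3]
    by_contra hlt
    push Not at hlt
    have h1 : ‖z‖ ^ 2 < (τ ^ 3) ^ 2 := by gcongr
    have h2 : ‖mu‖ < M * (τ ^ 3) ^ 2 := hmuz.trans_lt (by gcongr)
    rw [← hτ4] at h2 hMτ2
    nlinarith [mul_lt_mul_of_pos_right hMτ2 (pow_pos hτpos 2), pow_pos hτpos 4]
  · refine LocalBounds.liftBounds hA (hloc _ (hfib₀ ▸ hmem₁)) hfd hfne (by simpa using A0) ?_ ?_
    · intro u
      calc _ ≤ 1 * (C * ‖u‖) := by
            gcongr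
            exact (hf t).fderiv_le z hz1 u
        _ ≤ A * ‖u‖ := by rw [one_mul]; gcongr
    · intro u
      calc _ ≤ C * ‖z‖ ^ s * ‖u‖ := (hf t).fderiv_snd_le z hz1 u
        _ = C / c₀ * (c₀ * ‖z‖ ^ s) * ‖u‖ := by field_simp
        _ ≤ A * ‖(K.f₁ t z).2‖ * ‖u‖ := by gcongr
  · refine LocalBounds.liftBounds hA (hloc _ hmem) hφd hφne ?_ ?_ ?_
    -- Here |λ| ≤ CC'(M|z|²)^s and |φ^x|² ≥ c₀²|z|^{2s}, so the powers of z match.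
    · rw [norm_div, norm_neg, norm_pow, div_le_iff₀ (by positivity)]
      calc ‖lam‖ ≤ C * C' * ‖mu‖ ^ s := hlamle
        _ ≤ C * C' * (M * ‖z‖ ^ 2) ^ s := by gcongr
        _ = C * C' * M ^ s / c₀ ^ 2 * (c₀ * ‖z‖ ^ s) ^ 2 := by
            rw [mul_pow, ← pow_mul, mul_pow, ← pow_mul, mul_comm s 2]; field_simp
        _ ≤ A * ‖(φ z).2‖ ^ 2 := by gcongr
    · intro u
      obtain ⟨h1, h2⟩ := hφf u
      have h3 : ‖z‖ * ‖fderiv ℝ φ z u‖ =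
          max (‖z‖ * ‖(fderiv ℝ φ z u).1‖) (‖z‖ * ‖(fderiv ℝ φ z u).2‖) := by
        rw [Prod.norm_def, mul_max_of_nonneg _ _ (norm_nonneg _)]
      rw [h3]
      refine max_le (h1.trans (by gcongr)) (h2.trans ?_)
      have h4 : ‖z‖ ^ s ≤ 1 := pow_le_one₀ (norm_nonneg _) hz1
      calc _ ≤ (5 + s) * C * 1 * ‖u‖ := by gcongr
        _ ≤ A * ‖u‖ := by rw [mul_one]; gcongr
    · intro u
      calc _ ≤ (5 + s) * C * ‖z‖ ^ s * ‖u‖ := (hφf u).2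
        _ = (5 + s) * C / c₀ * (c₀ * ‖z‖ ^ s) * ‖u‖ := by field_simp
        _ ≤ A * ‖(φ z).2‖ * ‖u‖ := by gcongr
  · exact approxMap_eventuallyEq hM hz ha0 hmu hab hβ hMτ2 hφd hφne

end Assembly

end SymplecticSum

end

/-! ### The lemma -/

theorem mainTheorem5 {E : Type*} [NormedAddCommGroup E] [NormedSpace ℝ E] [FiniteDimensional ℝ E]
    {T : Type*} [TopologicalSpace T] [CompactSpace T]
    (U : Set (E × ℂ × ℂ))
    (g : E × ℂ × ℂ → (E × ℂ × ℂ) →L[ℝ] (E × ℂ × ℂ) →L[ℝ] ℝ)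
    (J : E × ℂ × ℂ → (E × ℂ × ℂ) →L[ℝ] (E × ℂ × ℂ))
    (hZ : SymplecticSum.IsLocalModel U g J)
    (s : ℕ) (R : ℝ) (K : SymplecticSum.NodalFamily T U s R) (M : ℝ) (hM : 0 < M) :
    ∃ c > 0, ∃ lamM > 0, ∀ (t : T) (lam mu : ℂ) (β : ℂ → ℝ),
      lam ≠ 0 → ‖lam‖ ≤ lamM → K.a t * K.b t * mu ^ s = lam → SymplecticSum.IsCutoff mu β →
      ∀ f : ℂ → E × ℂ, f = K.f₁ t →
      ∀ F : ℂ → E × ℂ × ℂ,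
        F = SymplecticSum.approxMap s (K.f₁ t) (K.f₂ t) (K.p t) (K.a t) (K.b t) mu β →
      ∀ z ∈ SymplecticSum.omegaPlus M mu,
        -- `F(z)` is a point of `Z_λ` in the chart
        (F z ∈ U ∧ (F z).2.1 * (F z).2.2 = lam) ∧
        -- sections
        (∀ ξ : ℂ → E × ℂ, DifferentiableAt ℝ ξ z →
          c⁻¹ * SymplecticSum.vecNorm (SymplecticSum.metricX g) (f z) (ξ z)
              ≤ SymplecticSum.vecNorm g (F z) (SymplecticSum.hat lam F ξ z) ∧
          SymplecticSum.vecNorm g (F z) (SymplecticSum.hat lam F ξ z)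
              ≤ c * SymplecticSum.vecNorm (SymplecticSum.metricX g) (f z) (ξ z) ∧
          SymplecticSum.gradNormZ g lam mu F (SymplecticSum.hat lam F ξ) z
              ≤ c * (SymplecticSum.gradNormX g f ξ z +
                  SymplecticSum.vecNorm (SymplecticSum.metricX g) (f z) (ξ z)) ∧
          ((ξ z).2 = 0 → (SymplecticSum.hat lam F ξ z).2 = 0)) ∧
        -- 1-forms
        (∀ η : ℂ → ℂ →L[ℝ] (E × ℂ), DifferentiableAt ℝ η z →
          c⁻¹ * SymplecticSum.formNormX g f η z
              ≤ SymplecticSum.formNormZ g mu F (SymplecticSum.hatForm lam F η) z ∧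
          SymplecticSum.formNormZ g mu F (SymplecticSum.hatForm lam F η) z
              ≤ c * SymplecticSum.formNormX g f η z ∧
          SymplecticSum.formGradNormZ g lam mu F (SymplecticSum.hatForm lam F η) z
              ≤ c * (SymplecticSum.formGradNormX g f η z + SymplecticSum.formNormX g f η z) ∧
          ((∀ u, (η z u).2 = 0) → ∀ u, (SymplecticSum.hatForm lam F η z u).2 = 0)) ∧
        -- `(0,1)`-forms
        (∀ η : ℂ → ℂ →L[ℝ] (E × ℂ), DifferentiableAt ℝ η z →
          SymplecticSum.IsZeroOne J f (SymplecticSum.plusRegion mu R) η →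
          c⁻¹ * SymplecticSum.formNormX g f η z
              ≤ SymplecticSum.formNormZ g mu F (SymplecticSum.hatZeroOne J lam F η) z ∧
          SymplecticSum.formNormZ g mu F (SymplecticSum.hatZeroOne J lam F η) z
              ≤ c * SymplecticSum.formNormX g f η z ∧
          SymplecticSum.formGradNormZ g lam mu F (SymplecticSum.hatZeroOne J lam F η) z
              ≤ c * (SymplecticSum.formGradNormX g f η z + SymplecticSum.formNormX g f η z) ∧
          ((η z 1).2 = 0 → (SymplecticSum.hatZeroOne J lam F η z 1).2 = 0)) := by

  obtain ⟨A, hA, lamM, hlamM, h⟩ := SymplecticSum.exists_liftBounds hZ K hM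
  have hA0 : 0 < A := by linarith
  -- The constant of the gradient estimate for (0,1)-forms; as A ≥ 1 it dominates all the others.
  refine ⟨784 * A ^ 6, by positivity, lamM, hlamM, ?_⟩
  rintro t lam mu β hlam hle hab hβ f rfl F rfl z hz
  obtain ⟨hplus, hU, h₀, h₁, hev⟩ := h t lam mu β hlam hle hab hβ z hz
  have hz0 := hz.1
  have hFz := hev.self_of_nhds
  have hpow : ∀ k ≤ 6, A ^ k ≤ A ^ 6 := fun k hk => pow_le_pow_right₀ hA hk
  have hA6 : 0 < A ^ 6 := by positivity
  have c1 : A ^ 3 ≤ 784 * A ^ 6 := by linarith [hpow 3 (by norm_num)]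
  have c2 : 4 * A ^ 4 ≤ 784 * A ^ 6 := by linarith [hpow 4 (by norm_num)]
  have c3 : 2 * A ^ 3 ≤ 784 * A ^ 6 := by linarith [hpow 3 (by norm_num)]
  have c4 : 728 * A ^ 5 ≤ 784 * A ^ 6 := by linarith [hpow 5 (by norm_num)]
  have c5 : 2 * A ^ 4 ≤ 784 * A ^ 6 := by linarith [hpow 4 (by norm_num)]
  have hc : 0 < 784 * A ^ 6 := by positivity
  have mono : ∀ {x y k : ℝ}, 0 ≤ y → k ≤ 784 * A ^ 6 → x ≤ k * y → x ≤ 784 * A ^ 6 * y :=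
    fun hy hk hx => hx.trans (mul_le_mul_of_nonneg_right hk hy)
  refine ⟨⟨hFz ▸ hU, ?_⟩, fun ξ _ => ?_, fun η _ => ?_, fun η hη hJ => ?_⟩
  · rw [hFz]
    exact mul_div_cancel₀ lam h₁.ne_zero
  · obtain ⟨e1, e2, e3, e4⟩ := h₀.section_estimates (mu := mu) hA hz0 h₁ hev ξ
    refine ⟨(inv_mul_le_iff₀ hc).mpr (mono (Real.sqrt_nonneg _) c1 e1),
      mono (Real.sqrt_nonneg _) c1 e2, mono ?_ c2 e3, e4⟩
    exact add_nonneg (Real.sqrt_nonneg _) (Real.sqrt_nonneg _)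
  · obtain ⟨e1, e2, e3, e4⟩ := h₀.form_estimates (mu := mu) hA hz0 h₁ hev η
    refine ⟨(inv_mul_le_iff₀ hc).mpr (mono (Real.sqrt_nonneg _) c3 e1),
      mono (Real.sqrt_nonneg _) c3 e2, mono ?_ c4 e3, e4⟩
    exact add_nonneg (Real.sqrt_nonneg _) (Real.sqrt_nonneg _)
  · obtain ⟨e1, e2, e3, e4⟩ := h₀.zeroOne_estimates (mu := mu) hA hz0 h₁ hev η hη
      (hJ z hplus 1)
    refine ⟨(inv_mul_le_iff₀ hc).mpr (mono (Real.sqrt_nonneg _) c5 e1),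
      mono (Real.sqrt_nonneg _) c5 e2, mono ?_ le_rfl e3, e4⟩
    exact add_nonneg (Real.sqrt_nonneg _) (Real.sqrt_nonneg _)
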